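/- Let $m>0$, $1\le\alpha<2$, $T>0$ and let $\phi_-,\phi_+\in\mathbb R$ satisfy $0<|\phi_+-\phi_-|\le 2\pi$. Put $\bar V(z)=\frac{m}{\alpha|z|^{\alpha}}$ for $z\in\mathbb C\setminus\{0\}$, $\bar V(0)=+\infty$, and consider the Kepler-type problem $$\ddot x=\nabla\bar V(x)=-\frac{m\,x}{|x|^{\alpha+2}} .$$ Let $\mu=(\alpha+2)\big(\frac{m}{2\alpha}\big)^{1/2}$ and let $\bar x$ be the parabolic collision-ejection solution $$\bar x(t)=(\mu|t|)^{\frac{2}{\alpha+2}}e^{i\phi_+}\ (t\ge 0),\qquad \bar x(t)=(\mu|t|)^{\frac{2}{\alpha+2}}e^{i\phi_-}\ (t\le 0).$$ For $S>0$ let $\Gamma^*_S(\bar x;T)$ be the set of $x\in H^1([-S,S],\mathbb C\setminus\{0\})$ with $x(\pm S)=\bar x(\pm T)$ for which there is a continuous $\theta:[-S,S]\to\mathbb R$ with $x=|x|e^{i\theta}$, $\theta(-S)=\phi_-$ and $\theta(S)=\phi_+$. Let $\Gamma_S(\bar x;T)$ be the set of all limits in $H^1([-S,S],\mathbb C)$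 of weakly convergent sequences in $\Gamma^*_S(\bar x;T)$, and write $\Gamma^*_T(\bar x)=\Gamma^*_T(\bar x;T)$, $\Gamma_T(\bar x)=\Gamma_T(\bar x;T)$. Define, with values in $[0,\infty]$, $$\bar M(x)=\int_{-T}^{T}\tfrac12|\dot x|^2\,dt\int_{-T}^{T}\bar V(x)\,dt,\qquad \bar A_S(x)=\int_{-S}^{S}\Big(\tfrac12|\dot x|^2+\bar V(x)\Big)dt,$$ $$\bar m_T=\inf\{\bar M(x):x\in\Gamma_T(\bar x)\},\qquad \bar c(\bar x;T)=\inf\{\bar A_S(x):S>0,\ x\in\Gamma_S(\bar x;T)\}.$$ (a) There is $y\in\Gamma_T(\bar x)$ with $\bar M(y)=\bar m_T\in(0,\infty)$ such that, if $\alpha\in(1,2)$, or if $\alpha=1$ and $|\phi_+-\phi_-|<2\pi$, then $y\in\Gamma^*_T(\bar x)$ (so $y$ has no collision with the origin), $y$ is after a linear change of time a classical zero-energy solution of the Kepler-type problem, namely, with $\omega>0$ given by $\omega^2=\int_{-T}^{T}\bar V(y)\,dt\big/\int_{-T}^{T}\frac12|\dot y|^2\,dt$, the curve $x(t)=y(\omega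 t)$, $t\in[-T/\omega,T/\omega]$, satisfies $\ddot x=\nabla\bar V(x)$ and $\frac12|\dot x|^2-\bar V(x)=0$, and $\bar M(y)<\bar M(\bar x)$. (b) There are $S>0$ and $\eta\in\Gamma_S(\bar x;T)$ with $\bar A_S(\eta)=\bar c(\bar x;T)<\infty$ such that, if $\alpha\in(1,2)$, or if $\alpha=1$ and $|\phi_+-\phi_-|<2\pi$, then $\eta\in\Gamma^*_S(\bar x;T)$, $\eta$ is a classical solution on $[-S,S]$ of the Kepler-type problem with zero energy, and $\bar A_S(\eta)<\bar A_T(\bar x)$. -/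

import Mathlib

open MeasureTheory Set Filter Topology
open scoped ENNReal

noncomputable section

namespace Kepler

/-- `x ∈ H¹([a,b], ℂ)`: the (continuous representative of the) curve `x` is absolutely continuous
on `[a,b]` and its almost everywhere defined derivative is square integrable. Only the values of
`x` on `[a,b]` matter. -/
def MemH1 (a b : ℝ) (x : ℝ → ℂ) : Prop :=
  AbsolutelyContinuousOnInterval x a b ∧ MemLp (deriv x) 2 (volume.restrict (Icc a b))

/-- The continuous linear functional on `H¹([a,b], ℂ)` (as a real Hilbert space) given by a pair
`g₀, g₁` of square integrable functions. Every continuous linear functional is of this form. -/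
def h1Functional (a b : ℝ) (g₀ g₁ x : ℝ → ℂ) : ℝ :=
  ∫ t in Icc a b, (inner ℝ (g₀ t) (x t) + inner ℝ (g₁ t) (deriv x t))

/-- Weak convergence in `H¹([a,b], ℂ)` of the sequence `xs` to `x`. -/
def WeakH1Tendsto (a b : ℝ) (xs : ℕ → ℝ → ℂ) (x : ℝ → ℂ) : Prop :=
  ∀ g₀ g₁ : ℝ → ℂ, MemLp g₀ 2 (volume.restrict (Icc a b)) →
    MemLp g₁ 2 (volume.restrict (Icc a b)) →
    Tendsto (fun n => h1Functional a b g₀ g₁ (xs n)) atTop (𝓝 (h1Functional a b g₀ g₁ x))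

/-- The weak (sequential) closure in `H¹([a,b], ℂ)` of a set of curves. -/
def weakH1Closure (a b : ℝ) (C : Set (ℝ → ℂ)) : Set (ℝ → ℂ) :=
  {x | MemH1 a b x ∧ ∃ xs : ℕ → ℝ → ℂ, (∀ n, xs n ∈ C) ∧ WeakH1Tendsto a b xs x}

/-- The negative potential `m / (α |z|^α)`, with value `∞` at the origin (for `m, α > 0`). -/
def potential (m α : ℝ) (z : ℂ) : ℝ≥0∞ :=
  ENNReal.ofReal m / (ENNReal.ofReal α * ‖z‖ₑ ^ α)

/-- `∫_a^b ½ |ẋ|² dt`. -/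
def kineticIntegral (a b : ℝ) (x : ℝ → ℂ) : ℝ≥0∞ :=
  ∫⁻ t in Icc a b, 2⁻¹ * ‖deriv x t‖ₑ ^ 2

/-- `∫_a^b V(x) dt`. -/
def potentialIntegral (m α a b : ℝ) (x : ℝ → ℂ) : ℝ≥0∞ :=
  ∫⁻ t in Icc a b, potential m α (x t)

/-- The action `∫_{-S}^{S} (½ |ẋ|² + V(x)) dt`. -/
def action (m α S : ℝ) (x : ℝ → ℂ) : ℝ≥0∞ :=
  ∫⁻ t in Icc (-S) S, (2⁻¹ * ‖deriv x t‖ₑ ^ 2 + potential m α (x t))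

/-- The zero-energy Maupertuis functional `∫_{-T}^{T} ½ |ẋ|² dt · ∫_{-T}^{T} V(x) dt`. -/
def maupertuis (m α T : ℝ) (x : ℝ → ℂ) : ℝ≥0∞ :=
  kineticIntegral (-T) T x * potentialIntegral m α (-T) T x

/-- The constant `μ = (α + 2) (m / (2α))^{1/2}`. -/
def mu (m α : ℝ) : ℝ := (α + 2) * Real.sqrt (m / (2 * α))

/-- The parabolic collision-ejection solution with angles `φm = φ₋` and `φp = φ₊`. -/
def xbar (m α φm φp : ℝ) (t : ℝ) : ℂ :=
  (((mu m α * |t|) ^ (2 / (α + 2)) : ℝ) : ℂ) *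
    Complex.exp (((if 0 ≤ t then φp else φm : ℝ) : ℂ) * Complex.I)

/-- The class `Γ*_S(x̄; T)`: collision-free `H¹` curves on `[-S, S]` from `x̄(-T)` to `x̄(T)` whose
argument, followed continuously along the curve, goes from `φ₋` to `φ₊`. -/
def GammaStar (m α φm φp T S : ℝ) : Set (ℝ → ℂ) :=
  {x | MemH1 (-S) S x ∧ (∀ t ∈ Icc (-S) S, x t ≠ 0) ∧
    x (-S) = xbar m α φm φp (-T) ∧ x S = xbar m α φm φp T ∧
    ∃ θ : ℝ → ℝ, ContinuousOn θ (Icc (-S) S) ∧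
      (∀ t ∈ Icc (-S) S, x t = (‖x t‖ : ℂ) * Complex.exp ((θ t : ℂ) * Complex.I)) ∧
      θ (-S) = φm ∧ θ S = φp}

/-- The class `Γ_S(x̄; T)`; for `S = T` this is `Γ_T(x̄)`. -/
def Gamma (m α φm φp T S : ℝ) : Set (ℝ → ℂ) :=
  weakH1Closure (-S) S (GammaStar m α φm φp T S)

/-- The infimum of the Maupertuis functional on `Γ_T(x̄)`. -/
def maupertuisInf (m α φm φp T : ℝ) : ℝ≥0∞ :=
  ⨅ x ∈ Gamma m α φm φp T T, maupertuis m α T x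

/-- The free-time infimum of the action, over all `S > 0` and all curves in `Γ_S(x̄; T)`. -/
def freeTimeActionInf (m α φm φp T : ℝ) : ℝ≥0∞ :=
  ⨅ S ∈ Ioi (0 : ℝ), ⨅ x ∈ Gamma m α φm φp T S, action m α S x

/-- `x` is, on `[a,b]`, a classical collision-free solution of `ẍ = -m x / |x|^{α+2}` with energy
`½ |ẋ|² - m / (α |x|^α) = 0` (one-sided derivatives at the endpoints). -/
def IsZeroEnergySolution (m α a b : ℝ) (x : ℝ → ℂ) : Prop :=
  ∃ v : ℝ → ℂ, ∀ t ∈ Icc a b, x t ≠ 0 ∧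
    HasDerivWithinAt x (v t) (Icc a b) t ∧
    HasDerivWithinAt v (-(m / ‖x t‖ ^ (α + 2)) • x t) (Icc a b) t ∧
    ‖v t‖ ^ 2 / 2 - m / (α * ‖x t‖ ^ α) = 0

end Kepler

end

/-!
Put `β = 1 - α / 2`. The Jacobi metric `|dz|² / |z| ^ α` of the zero-energy problem is a flat cone:
up to a constant it is the pullback of the Euclidean metric under `z ↦ z ^ β`. By the
Cauchy-Schwarz inequality the Maupertuis functional dominates a multiple of the squared flat length,
and by the inequality between the arithmetic and the geometric mean the action dominates a multiple
of the flat length.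

The endpoints `x̄(±T)` lie at the flat distance `R ^ β` from the apex, where `R = |x̄(±T)|`, and
enclose the flat angle `2 γ = β |φ₊ - φ₋|` there. If `2 γ < π`, then every admissible curve has flat
length at least that of the straight chord, `2 R ^ β sin γ`, and curves through the apex are longer.
Both functionals attain their bounds along the chord traversed with zero energy, that is along
`w ^ (1 / β)` with `w` running through a segment. If `2 γ ≥ π`, the flat length is at least
`2 R ^ β`, the length of `x̄` itself; for `1 ≤ α` and `|φ₊ - φ₋| ≤ 2 π` this happens only when
`α = 1` and `|φ₊ - φ₋| = 2 π`. That `x̄` is admissible follows by rounding off its corner at the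
origin.
-/

noncomputable section

section AbsoluteContinuity

variable {X Y : Type*} [PseudoMetricSpace X] [PseudoMetricSpace Y] {a b : ℝ}

theorem absolutelyContinuousOnInterval_of_dist_le_mul {f : ℝ → X} {g : ℝ → Y} {δ K : ℝ}
    (hf : AbsolutelyContinuousOnInterval f a b) (hδ : 0 < δ)
    (hfg : ∀ s ∈ uIcc a b, ∀ t ∈ uIcc a b, dist s t < δ → dist (g s) (g t) ≤ K * dist (f s) (f t)) :
    AbsolutelyContinuousOnInterval g a b := by
  have hsum := Tendsto.const_mul K hf
  rw [mul_zero] at hsum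
  refine squeeze_zero' (.of_forall fun E => Finset.sum_nonneg fun i _ => dist_nonneg)
    (?_ : _ ≤ᶠ[_] _) hsum
  have hshort := (AbsolutelyContinuousOnInterval.hasBasis_totalLengthFilter (X := ℝ)).mem_of_mem hδ
  filter_upwards [inter_mem_inf hshort (mem_principal_self _)] with E hE
  rw [Finset.mul_sum]
  refine Finset.sum_le_sum fun i hi => hfg _ (hE.2.1 i hi).1 _ (hE.2.1 i hi).2 ?_
  exact (Finset.single_le_sum (f := fun i => dist (E.2 i).1 (E.2 i).2)
    (fun _ _ => dist_nonneg) hi).trans_lt hE.1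

theorem absolutelyContinuousOnInterval_comp_of_lipschitzOnWith {f : ℝ → X} {φ : X → Y} {K : NNReal}
    (hφ : LipschitzOnWith K φ (f '' uIcc a b)) (hf : AbsolutelyContinuousOnInterval f a b) :
    AbsolutelyContinuousOnInterval (fun t => φ (f t)) a b :=
  absolutelyContinuousOnInterval_of_dist_le_mul hf one_pos fun _ hs _ ht _ =>
    hφ.dist_le_mul _ (mem_image_of_mem f hs) _ (mem_image_of_mem f ht)

theorem absolutelyContinuousOnInterval_comp_of_contDiff {E F : Type*}
    [NormedAddCommGroup E] [NormedSpace ℝ E] [ProperSpace E]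
    [NormedAddCommGroup F] [NormedSpace ℝ F] {φ : E → F} {f : ℝ → E}
    (hφ : ContDiff ℝ 1 φ) (hf : AbsolutelyContinuousOnInterval f a b) :
    AbsolutelyContinuousOnInterval (fun t => φ (f t)) a b := by
  obtain ⟨C, hC⟩ := hf.exists_bound
  obtain ⟨K, hK⟩ := (hφ.contDiffOn (s := Metric.closedBall 0 C)).exists_lipschitzOnWith
    one_ne_zero (convex_closedBall _ _) (isCompact_closedBall _ _)
  refine absolutelyContinuousOnInterval_comp_of_lipschitzOnWith (hK.mono ?_) hf
  rintro _ ⟨t, ht, rfl⟩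
  exact mem_closedBall_zero_iff.2 (hC t ht)

theorem absolutelyContinuousOnInterval_congr {f g : ℝ → X} (hfg : EqOn f g (uIcc a b))
    (hf : AbsolutelyContinuousOnInterval f a b) : AbsolutelyContinuousOnInterval g a b :=
  absolutelyContinuousOnInterval_of_dist_le_mul (K := 1) hf one_pos fun _ hs _ ht _ => by
    rw [hfg hs, hfg ht, one_mul]

theorem norm_le_two_mul_norm_exp_sub_one {z : ℂ} (hz : ‖z‖ ≤ 1 / 2) :
    ‖z‖ ≤ 2 * ‖Complex.exp z - 1‖ := by
  have hexp := Complex.norm_exp_sub_one_sub_id_le (hz.trans one_half_lt_one.le)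
  have htri : ‖z‖ - ‖Complex.exp z - 1‖ ≤ ‖Complex.exp z - 1 - z‖ :=
    (norm_sub_norm_le z _).trans_eq (norm_sub_rev z _)
  nlinarith [norm_nonneg z]

theorem absolutelyContinuousOnInterval_of_exp {ℓ : ℝ → ℂ} (hℓ : ContinuousOn ℓ (uIcc a b))
    (hexp : AbsolutelyContinuousOnInterval (fun t => Complex.exp (ℓ t)) a b) :
    AbsolutelyContinuousOnInterval ℓ a b := by
  obtain ⟨t₀, -, ht₀⟩ := isCompact_uIcc.exists_isMinOn nonempty_uIcc hexp.continuousOn.norm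
  obtain ⟨δ, hδ, huc⟩ := Metric.uniformContinuousOn_iff.1
    (isCompact_uIcc.uniformContinuousOn_of_continuous hℓ) (1 / 2) one_half_pos
  set r : ℝ := ‖Complex.exp (ℓ t₀)‖
  have hr : 0 < r := norm_pos_iff.2 (Complex.exp_ne_zero _)
  refine absolutelyContinuousOnInterval_of_dist_le_mul (K := 2 / r) hexp hδ fun s hs t ht hst => ?_
  have hmin : r ≤ ‖Complex.exp (ℓ t)‖ := ht₀ ht
  have hfactor : dist (Complex.exp (ℓ s)) (Complex.exp (ℓ t)) =
      ‖Complex.exp (ℓ t)‖ * ‖Complex.exp (ℓ s - ℓ t) - 1‖ := by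
    rw [dist_eq_norm, ← norm_mul, mul_sub, ← Complex.exp_add, add_sub_cancel, mul_one]
  calc dist (ℓ s) (ℓ t) ≤ 2 * ‖Complex.exp (ℓ s - ℓ t) - 1‖ := by
        rw [dist_eq_norm]
        exact norm_le_two_mul_norm_exp_sub_one (dist_eq_norm (ℓ s) (ℓ t) ▸ (huc s hs t ht hst).le)
    _ = 2 / r * (r * ‖Complex.exp (ℓ s - ℓ t) - 1‖) := by field_simp
    _ ≤ 2 / r * dist (Complex.exp (ℓ s)) (Complex.exp (ℓ t)) := by
        rw [hfactor]
        gcongr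

variable {E : Type*} [NormedAddCommGroup E] [NormedSpace ℝ E]

theorem absolutelyContinuousOnInterval_of_hasDerivAt_off_countable [CompleteSpace E]
    {f f' : ℝ → E} {s : Set ℝ} (hs : s.Countable) (hf : ContinuousOn f (uIcc a b))
    (hderiv : ∀ t ∈ uIcc a b \ s, HasDerivAt f (f' t) t) (hint : IntervalIntegrable f' volume a b) :
    AbsolutelyContinuousOnInterval f a b := by
  refine absolutelyContinuousOnInterval_of_dist_le_mul (K := 1) (δ := 1)
    (hint.norm.absolutelyContinuousOnInterval_intervalIntegral left_mem_uIcc) one_pos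
    fun u hu v hv _ => ?_
  have hsub : uIcc u v ⊆ uIcc a b := uIcc_subset_uIcc hu hv
  have hftc := integral_eq_of_hasDerivAt_off_countable f f' hs (hf.mono hsub)
    (fun t ht => hderiv t ⟨hsub (Ioo_subset_Icc_self ht.1), ht.2⟩) (hint.mono_set hsub)
  have hnorm : ∀ t ∈ uIcc a b, IntervalIntegrable (fun t => ‖f' t‖) volume a t := fun t ht =>
    hint.norm.mono_set (uIcc_subset_uIcc left_mem_uIcc ht)
  rw [one_mul, dist_comm, dist_eq_norm, ← hftc, dist_comm, dist_eq_norm,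
    intervalIntegral.integral_interval_sub_left (hnorm v hv) (hnorm u hu), Real.norm_eq_abs]
  exact intervalIntegral.norm_integral_le_abs_integral_norm

variable [FiniteDimensional ℝ E] {f : ℝ → E}

theorem ae_differentiableAt_of_absolutelyContinuousOnInterval
    (hf : AbsolutelyContinuousOnInterval f a b) :
    ∀ᵐ t : ℝ, t ∈ uIcc a b → DifferentiableAt ℝ f t :=
  hf.boundedVariationOn.ae_differentiableAt_of_mem_uIcc

theorem ae_deriv_clm_comp_of_absolutelyContinuousOnInterval (L : E →L[ℝ] ℝ)
    (hf : AbsolutelyContinuousOnInterval f a b) :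
    ∀ᵐ t : ℝ, t ∈ uIcc a b → deriv (fun s => L (f s)) t = L (deriv f t) := by
  filter_upwards [ae_differentiableAt_of_absolutelyContinuousOnInterval hf] with t ht hmem
  exact (L.hasFDerivAt.comp_hasDerivAt t (ht hmem).hasDerivAt).deriv

theorem intervalIntegrable_deriv_of_absolutelyContinuousOnInterval
    (hf : AbsolutelyContinuousOnInterval f a b) : IntervalIntegrable (deriv f) volume a b := by
  have hclm : ∀ L : E →L[ℝ] ℝ, IntervalIntegrable (fun t => L (deriv f t)) volume a b := by
    intro L
    have hL := absolutelyContinuousOnInterval_comp_of_contDiff L.contDiff hf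
    refine hL.intervalIntegrable_deriv.congr_ae
      ((ae_restrict_iff' measurableSet_uIoc).2 ?_)
    filter_upwards [ae_deriv_clm_comp_of_absolutelyContinuousOnInterval L hf] with t ht hmem
    exact ht (uIoc_subset_uIcc hmem)
  let e := Module.finBasis ℝ E
  have hsum : deriv f = ∑ i, fun t => (e.coord i).toContinuousLinearMap (deriv f t) • e i := by
    funext t
    simp only [Finset.sum_apply, LinearMap.coe_toContinuousLinearMap', Module.Basis.coord_apply,
      e.sum_repr]
  rw [hsum]
  exact IntervalIntegrable.sum _ fun i _ =>
    ⟨(hclm _).1.smul_const _, (hclm _).2.smul_const _⟩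

theorem integral_deriv_eq_sub_of_absolutelyContinuousOnInterval
    (hf : AbsolutelyContinuousOnInterval f a b) : ∫ t in a..b, deriv f t = f b - f a := by
  refine (SeparatingDual.eq_iff_forall_dual_eq (R := ℝ)).2 fun L => ?_
  have hL := absolutelyContinuousOnInterval_comp_of_contDiff L.contDiff hf
  have hint := intervalIntegrable_deriv_of_absolutelyContinuousOnInterval hf
  rw [← L.intervalIntegral_comp_comm hint, map_sub, ← hL.integral_deriv_eq_sub]
  refine intervalIntegral.integral_congr_ae ?_
  filter_upwards [ae_deriv_clm_comp_of_absolutelyContinuousOnInterval L hf] with t ht hmem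
  exact (ht (uIoc_subset_uIcc hmem)).symm

theorem enorm_sub_le_lintegral_enorm_deriv (hab : a ≤ b)
    (hf : AbsolutelyContinuousOnInterval f a b) :
    ‖f b - f a‖ₑ ≤ ∫⁻ t in Icc a b, ‖deriv f t‖ₑ := by
  rw [← integral_deriv_eq_sub_of_absolutelyContinuousOnInterval hf,
    intervalIntegral.integral_of_le hab, restrict_Ioc_eq_restrict_Icc]
  exact enorm_integral_le_lintegral_enorm _

end AbsoluteContinuity

section ContinuousArgument

theorem div_mem_slitPlane_of_dist_lt_norm {z w : ℂ} (h : dist z w < ‖w‖) :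
    z / w ∈ Complex.slitPlane := by
  have hw : w ≠ 0 := norm_pos_iff.1 (dist_nonneg.trans_lt h)
  rw [← add_sub_cancel 1 (z / w)]
  refine Complex.mem_slitPlane_of_norm_lt_one ?_
  rwa [div_sub_one hw, norm_div, div_lt_one (norm_pos_iff.2 hw), ← dist_eq_norm]

theorem exists_continuousOn_arg_of_dist_lt_norm {X : Type*} [TopologicalSpace X] {s : Set X}
    {x y : X → ℂ} {θ : X → ℝ} (hx : ContinuousOn x s) (hy : ContinuousOn y s)
    (hθ : ContinuousOn θ s) (hyθ : ∀ t ∈ s, y t = ‖y t‖ * Complex.exp (θ t * Complex.I))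
    (hyx : ∀ t ∈ s, dist (y t) (x t) < ‖x t‖) :
    ∃ ψ : X → ℝ, ContinuousOn ψ s ∧ (∀ t ∈ s, x t = ‖x t‖ * Complex.exp (ψ t * Complex.I)) ∧
      ∀ t ∈ s, y t = x t → ψ t = θ t := by
  have hx0 : ∀ t ∈ s, x t ≠ 0 := fun t ht => norm_pos_iff.1 (dist_nonneg.trans_lt (hyx t ht))
  have hslit := fun t ht => div_mem_slitPlane_of_dist_lt_norm (hyx t ht)
  refine ⟨fun t => θ t - (y t / x t).arg, hθ.sub fun t ht => ?_, fun t ht => ?_, fun t ht hxy => ?_⟩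
  · exact ContinuousAt.comp_continuousWithinAt (f := fun t => y t / x t)
      (Complex.continuousAt_arg (hslit t ht)) (hy.div hx hx0 t ht)
  · have hy0 : y t ≠ 0 := fun h => Complex.slitPlane_ne_zero (hslit t ht) (by simp [h])
    have hn : (‖y t‖ : ℂ) ≠ 0 := by simpa using hy0
    have hnx : (‖x t‖ : ℂ) ≠ 0 := by simpa using hx0 t ht
    have hexp : Complex.exp (θ t * Complex.I) = y t / ‖y t‖ := by
      rw [eq_div_iff hn, mul_comm, ← hyθ t ht]
    have hdiv : Complex.exp ((y t / x t).arg * Complex.I) = y t / x t * (‖x t‖ / ‖y t‖) := by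
      rw [← mul_right_inj' (div_ne_zero hn hnx), ← Complex.ofReal_div, ← norm_div,
        Complex.norm_mul_exp_arg_mul_I, norm_div, Complex.ofReal_div]
      field_simp
    rw [Complex.ofReal_sub, sub_mul, Complex.exp_sub, hdiv, hexp]
    field_simp [hx0 t ht]
  · simp only [hxy, div_self (hx0 t ht), Complex.arg_one, sub_zero]

end ContinuousArgument

namespace Kepler

section WeakConvergence

variable {a b : ℝ} {x : ℝ → ℂ} {xs : ℕ → ℝ → ℂ}

theorem MemH1.continuousOn (hab : a ≤ b) (hx : MemH1 a b x) : ContinuousOn x (Icc a b) :=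
  uIcc_of_le hab ▸ hx.1.continuousOn

theorem MemH1.aestronglyMeasurable (hab : a ≤ b) (hx : MemH1 a b x) :
    AEStronglyMeasurable x (volume.restrict (Icc a b)) :=
  (hx.continuousOn hab).aestronglyMeasurable measurableSet_Icc

theorem weakH1Tendsto_of_dominated {F G : ℝ → ℝ} (hab : a ≤ b) (hxs : ∀ n, MemH1 a b (xs n))
    (hF : MemLp F 2 (volume.restrict (Icc a b))) (hG : MemLp G 2 (volume.restrict (Icc a b)))
    (hxsF : ∀ n, ∀ᵐ t ∂volume.restrict (Icc a b), ‖xs n t‖ ≤ F t)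
    (hxsG : ∀ n, ∀ᵐ t ∂volume.restrict (Icc a b), ‖deriv (xs n) t‖ ≤ G t)
    (hlim : ∀ᵐ t ∂volume.restrict (Icc a b), Tendsto (fun n => xs n t) atTop (𝓝 (x t)))
    (hlim' : ∀ᵐ t ∂volume.restrict (Icc a b),
      Tendsto (fun n => deriv (xs n) t) atTop (𝓝 (deriv x t))) :
    WeakH1Tendsto a b xs x := by
  intro g₀ g₁ hg₀ hg₁
  refine tendsto_integral_of_dominated_convergence (fun t => ‖g₀ t‖ * F t + ‖g₁ t‖ * G t)
    (fun n => (hg₀.1.inner ((hxs n).aestronglyMeasurable hab)).add (hg₁.1.inner (hxs n).2.1))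
    ((hg₀.norm.integrable_mul hF).add (hg₁.norm.integrable_mul hG)) (fun n => ?_) ?_
  · filter_upwards [hxsF n, hxsG n] with t hFt hGt
    calc ‖inner ℝ (g₀ t) (xs n t) + inner ℝ (g₁ t) (deriv (xs n) t)‖
        ≤ ‖g₀ t‖ * ‖xs n t‖ + ‖g₁ t‖ * ‖deriv (xs n) t‖ :=
          norm_add_le_of_le (norm_inner_le_norm _ _) (norm_inner_le_norm _ _)
      _ ≤ ‖g₀ t‖ * F t + ‖g₁ t‖ * G t := by gcongr
  · filter_upwards [hlim, hlim'] with t ht ht'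
    exact (tendsto_const_nhds.inner ht).add (tendsto_const_nhds.inner ht')

theorem intervalIntegrable_add_sub_smul_deriv (c : ℝ) (hx : AbsolutelyContinuousOnInterval x a b) :
    IntervalIntegrable (fun s => x s + (s - c) • deriv x s) volume a b :=
  hx.continuousOn.intervalIntegrable.add
    ((intervalIntegrable_deriv_of_absolutelyContinuousOnInterval hx).continuousOn_smul
      (by fun_prop : Continuous fun s => s - c).continuousOn)

theorem integral_add_sub_smul_deriv (c : ℝ) (hx : AbsolutelyContinuousOnInterval x a b) :
    ∫ s in a..b, (x s + (s - c) • deriv x s) = (b - c) • x b - (a - c) • x a := by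
  have hlin : AbsolutelyContinuousOnInterval (fun s : ℝ => s - c) a b :=
    ContDiffOn.absolutelyContinuousOnInterval (by fun_prop)
  rw [← integral_deriv_eq_sub_of_absolutelyContinuousOnInterval (hlin.fun_smul hx)]
  refine intervalIntegral.integral_congr_ae ?_
  filter_upwards [ae_differentiableAt_of_absolutelyContinuousOnInterval hx] with s hs hmem
  rw [(((hasDerivAt_id' s).sub_const c).fun_smul (hs (uIoc_subset_uIcc hmem)).hasDerivAt).deriv,
    one_smul, add_comm]

/-- The kernel `k` with `∫ s in a..b, (x s + k s • x' s) = (b - a) • x t`, so that evaluation at `t`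
is one of the functionals `h1Functional`. -/
def evalKernel (a b t s : ℝ) : ℝ := if s ≤ t then s - a else s - b

theorem abs_evalKernel_le {s : ℝ} (hs : s ∈ Icc a b) (t : ℝ) : |evalKernel a b t s| ≤ b - a := by
  rw [evalKernel, abs_le]
  split_ifs <;> constructor <;> linarith [hs.1, hs.2]

theorem memLp_evalKernel_smul (t : ℝ) (v : ℂ) :
    MemLp (fun s => evalKernel a b t s • v) 2 (volume.restrict (Icc a b)) := by
  have hmeas : Measurable (evalKernel a b t) :=
    Measurable.ite measurableSet_Iic (by fun_prop) (by fun_prop)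
  refine MemLp.of_bound (C := (b - a) * ‖v‖) (hmeas.smul_const v).aestronglyMeasurable ?_
  refine ae_restrict_of_forall_mem measurableSet_Icc fun s hs => ?_
  rw [norm_smul]
  gcongr
  exact abs_evalKernel_le hs t

theorem integrable_and_integral_add_evalKernel_smul_deriv {t : ℝ} (ht : t ∈ Icc a b)
    (hx : AbsolutelyContinuousOnInterval x a b) :
    Integrable (fun s => x s + evalKernel a b t s • deriv x s) (volume.restrict (Icc a b)) ∧
      ∫ s in Icc a b, (x s + evalKernel a b t s • deriv x s) = (b - a) • x t := by
  have hab := ht.1.trans ht.2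
  have htu : t ∈ uIcc a b := uIcc_of_le hab ▸ ht
  have hleft := hx.mono (uIcc_subset_uIcc left_mem_uIcc htu)
  have hright := hx.mono (uIcc_subset_uIcc htu right_mem_uIcc)
  have eleft : EqOn (fun s => x s + (s - a) • deriv x s)
      (fun s => x s + evalKernel a b t s • deriv x s) (uIoc a t) := fun s hs => by
    simp only [evalKernel, if_pos (uIoc_of_le ht.1 ▸ hs).2]
  have eright : EqOn (fun s => x s + (s - b) • deriv x s)
      (fun s => x s + evalKernel a b t s • deriv x s) (uIoc t b) := fun s hs => by
    simp only [evalKernel, if_neg (not_le.2 (uIoc_of_le ht.2 ▸ hs).1)]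
  have ileft := (intervalIntegrable_add_sub_smul_deriv a hleft).congr eleft
  have iright := (intervalIntegrable_add_sub_smul_deriv b hright).congr eright
  refine ⟨(intervalIntegrable_iff_integrableOn_Icc_of_le hab).1 (ileft.trans iright), ?_⟩
  rw [integral_Icc_eq_integral_Ioc, ← intervalIntegral.integral_of_le hab,
    ← intervalIntegral.integral_add_adjacent_intervals ileft iright,
    ← intervalIntegral.integral_congr_ae (.of_forall eleft),
    ← intervalIntegral.integral_congr_ae (.of_forall eright),
    integral_add_sub_smul_deriv a hleft, integral_add_sub_smul_deriv b hright]
  module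

theorem h1Functional_evalKernel {t : ℝ} (ht : t ∈ Icc a b) (v : ℂ)
    (hx : AbsolutelyContinuousOnInterval x a b) :
    h1Functional a b (fun _ => v) (fun s => evalKernel a b t s • v) x =
      (b - a) * inner ℝ v (x t) := by
  obtain ⟨hint, hval⟩ := integrable_and_integral_add_evalKernel_smul_deriv ht hx
  rw [h1Functional, ← real_inner_smul_right, ← hval, ← integral_inner hint]
  simp only [inner_add_right, real_inner_smul_left, real_inner_smul_right]

theorem WeakH1Tendsto.tendsto_apply (hab : a < b) (hxs : ∀ n, MemH1 a b (xs n))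
    (hx : MemH1 a b x) (h : WeakH1Tendsto a b xs x) {t : ℝ} (ht : t ∈ Icc a b) :
    Tendsto (fun n => xs n t) atTop (𝓝 (x t)) := by
  have hinner (v : ℂ) : Tendsto (fun n => inner ℝ v (xs n t)) atTop (𝓝 (inner ℝ v (x t))) := by
    have hfun := h _ _ (memLp_const v) (memLp_evalKernel_smul t v)
    simp only [h1Functional_evalKernel ht v hx.1,
      fun n => h1Functional_evalKernel ht v (hxs n).1] at hfun
    simpa only [inv_mul_cancel_left₀ (sub_ne_zero.2 hab.ne')] using hfun.const_mul (b - a)⁻¹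
  rw [Complex.equivRealProdCLM.toHomeomorph.isInducing.tendsto_nhds_iff, Prod.tendsto_iff]
  constructor
  · simpa [Complex.inner, Function.comp_def] using hinner 1
  · simpa [Complex.inner, Function.comp_def] using hinner Complex.I

theorem WeakH1Tendsto.exists_eLpNorm_deriv_le (hxs : ∀ n, MemH1 a b (xs n))
    (h : WeakH1Tendsto a b xs x) :
    ∃ C : NNReal, ∀ n, eLpNorm (deriv (xs n)) 2 (volume.restrict (Icc a b)) ≤ C := by
  set ν := volume.restrict (Icc a b)
  let L : ℕ → Lp ℂ 2 ν →L[ℝ] ℝ := fun n => innerSL ℝ ((hxs n).2.toLp (deriv (xs n)))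
  have hLbdd : ∀ g : Lp ℂ 2 ν, ∃ C, ∀ n, ‖L n g‖ ≤ C := by
    intro g
    have hL : ∀ n, L n g = h1Functional a b (fun _ => 0) g (xs n) := by
      intro n
      rw [innerSL_apply_apply, L2.inner_def, h1Functional]
      refine integral_congr_ae ?_
      filter_upwards [(hxs n).2.coeFn_toLp] with s hs
      rw [hs, inner_zero_left, zero_add, real_inner_comm]
    obtain ⟨C, hC⟩ := (h (fun _ => 0) g (memLp_const 0) (Lp.memLp g)).norm.bddAbove_range
    exact ⟨C, fun n => hL n ▸ hC (mem_range_self n)⟩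
  obtain ⟨C, hC⟩ := banach_steinhaus hLbdd
  have hC0 : 0 ≤ C := (norm_nonneg _).trans (hC 0)
  refine ⟨⟨C, hC0⟩, fun n => ?_⟩
  have hn := hC n
  rw [innerSL_apply_norm, Lp.norm_toLp] at hn
  rw [← ENNReal.ofReal_toReal (hxs n).2.2.ne]
  exact ENNReal.ofReal_le_of_le_toReal hn

theorem MemH1.dist_le_mul_sqrt {C : NNReal} (hx : MemH1 a b x)
    (hC : eLpNorm (deriv x) 2 (volume.restrict (Icc a b)) ≤ C)
    {s t : ℝ} (hs : s ∈ Icc a b) (ht : t ∈ Icc a b) :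
    dist (x s) (x t) ≤ C * √(dist s t) := by
  wlog hst : s ≤ t generalizing s t
  · rw [dist_comm, dist_comm s t]
    exact this ht hs (not_le.1 hst).le
  have hsub : Icc s t ⊆ Icc a b := Icc_subset_Icc hs.1 ht.2
  have hmono := Measure.restrict_mono hsub (le_refl volume)
  have hac := hx.1.mono (by rwa [uIcc_of_le hst, uIcc_of_le (hs.1.trans hs.2)])
  have hbound : ‖x t - x s‖ₑ ≤ C * ENNReal.ofReal √(t - s) := by
    calc ‖x t - x s‖ₑ ≤ eLpNorm (deriv x) 1 (volume.restrict (Icc s t)) := by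
          rw [eLpNorm_one_eq_lintegral_enorm]
          exact enorm_sub_le_lintegral_enorm_deriv hst hac
      _ ≤ _ := eLpNorm_le_eLpNorm_mul_rpow_measure_univ (q := 2) one_le_two
          (hx.2.1.mono_measure hmono)
      _ ≤ C * ENNReal.ofReal √(t - s) := by
          gcongr
          · exact (eLpNorm_mono_measure _ hmono).trans hC
          · rw [Measure.restrict_apply_univ, Real.volume_Icc, Real.sqrt_eq_rpow,
              ENNReal.ofReal_rpow_of_nonneg (sub_nonneg.2 hst) (by norm_num)]
            norm_num
  rw [dist_comm, dist_eq_norm, dist_comm, Real.dist_eq, abs_of_nonneg (sub_nonneg.2 hst)]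
  rwa [← ofReal_norm, ← ENNReal.ofReal_coe_nnreal, ← ENNReal.ofReal_mul C.coe_nonneg,
    ENNReal.ofReal_le_ofReal_iff (by positivity)] at hbound

theorem WeakH1Tendsto.tendstoUniformlyOn (hab : a < b) (hxs : ∀ n, MemH1 a b (xs n))
    (hx : MemH1 a b x) (h : WeakH1Tendsto a b xs x) :
    TendstoUniformlyOn xs x atTop (Icc a b) := by
  obtain ⟨C, hC⟩ := h.exists_eLpNorm_deriv_le hxs
  rw [tendstoUniformlyOn_iff_tendstoUniformly_comp_coe]
  let F : ℕ → Icc a b → ℂ := fun n => xs n ∘ (↑)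
  have hequi : Equicontinuous F := by
    refine Metric.equicontinuous_of_continuity_modulus (fun r => C * √r) ?_ F
      fun s t n => (hxs n).dist_le_mul_sqrt (hC n) s.2 t.2
    simpa using (by fun_prop : Continuous fun r : ℝ => C * √r).tendsto 0
  have hpointwise : Tendsto F atTop (𝓝 (x ∘ (↑))) :=
    tendsto_pi_nhds.2 fun t => h.tendsto_apply hab hxs hx t.2
  exact UniformFun.tendsto_iff_tendstoUniformly.1
    ((hequi.tendsto_uniformFun_iff_pi atTop _).2 hpointwise)

end WeakConvergence

section AdmissibleCurves

variable {m α φm φp T S : ℝ} {x : ℝ → ℂ}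

theorem GammaStar_subset_Gamma : GammaStar m α φm φp T S ⊆ Gamma m α φm φp T S := fun x hx =>
  ⟨hx.1, fun _ => x, fun _ => hx, fun _ _ _ _ => tendsto_const_nhds⟩

theorem endpoints_of_mem_Gamma (hS : 0 < S) (hx : x ∈ Gamma m α φm φp T S) :
    x (-S) = xbar m α φm φp (-T) ∧ x S = xbar m α φm φp T := by
  obtain ⟨hxH1, xs, hxs, hweak⟩ := hx
  have hab : -S < S := by linarith
  have hlim := fun t ht => hweak.tendsto_apply (t := t) hab (fun n => (hxs n).1) hxH1 ht
  constructor
  · refine tendsto_nhds_unique (hlim _ (left_mem_Icc.2 hab.le)) ?_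
    simp only [fun n => (hxs n).2.2.1, tendsto_const_nhds]
  · refine tendsto_nhds_unique (hlim _ (right_mem_Icc.2 hab.le)) ?_
    simp only [fun n => (hxs n).2.2.2.1, tendsto_const_nhds]

theorem mem_GammaStar_of_mem_Gamma (hS : 0 < S) (hx : x ∈ Gamma m α φm φp T S)
    (hx0 : ∀ t ∈ Icc (-S) S, x t ≠ 0) : x ∈ GammaStar m α φm φp T S := by
  obtain ⟨hl, hr⟩ := endpoints_of_mem_Gamma hS hx
  obtain ⟨hxH1, xs, hxs, hweak⟩ := hx
  have hab : -S < S := by linarith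
  have hcont := hxH1.continuousOn hab.le
  obtain ⟨t₀, ht₀, hmin⟩ := isCompact_Icc.exists_isMinOn (nonempty_Icc.2 hab.le) hcont.norm
  obtain ⟨n, hn⟩ := (Metric.tendstoUniformlyOn_iff.1
    (hweak.tendstoUniformlyOn hab (fun n => (hxs n).1) hxH1) _ (norm_pos_iff.2 (hx0 t₀ ht₀))).exists
  obtain ⟨hnH1, -, hnl, hnr, θ, hθ, hnθ, hθl, hθr⟩ := hxs n
  obtain ⟨ψ, hψ, hxψ, hψθ⟩ := exists_continuousOn_arg_of_dist_lt_norm hcont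
    (hnH1.continuousOn hab.le) hθ hnθ
    fun t ht => (dist_comm (xs n t) (x t)).trans_lt ((hn t ht).trans_le (hmin ht))
  refine ⟨hxH1, hx0, hl, hr, ψ, hψ, hxψ, ?_, ?_⟩
  · rw [hψθ _ (left_mem_Icc.2 hab.le) (hnl.trans hl.symm), hθl]
  · rw [hψθ _ (right_mem_Icc.2 hab.le) (hnr.trans hr.symm), hθr]

end AdmissibleCurves

end Kepler

section FlatLength

variable {E : Type*} [NormedAddCommGroup E]

/-- The length of the curve `x` in the conformal metric `β |z|^(β - 1) |dz|`. On `ℂ` this metric is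
a flat cone: it is the pullback of the Euclidean metric under `z ↦ z ^ β`. Where `x` vanishes the
integrand is `0` for `β ≠ 1`, by the convention `0 ^ (β - 1) = 0`. -/
def flatLength [NormedSpace ℝ E] (β a b : ℝ) (x : ℝ → E) : ℝ≥0∞ :=
  ∫⁻ t in Icc a b, ENNReal.ofReal (β * ‖x t‖ ^ (β - 1) * ‖deriv x t‖)

theorem flatLength_add_flatLength [NormedSpace ℝ E] {a b c : ℝ} (hab : a ≤ b) (hbc : b ≤ c)
    (β : ℝ) (x : ℝ → E) :
    flatLength β a b x + flatLength β b c x = flatLength β a c x := by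
  simp only [flatLength, ← restrict_Ioc_eq_restrict_Icc]
  rw [← Ioc_union_Ioc_eq_Ioc hab hbc,
    lintegral_union measurableSet_Ioc (Ioc_disjoint_Ioc_of_le le_rfl)]

variable [InnerProductSpace ℝ E] {β a b : ℝ} {x : ℝ → E}

-- `z ↦ ‖z‖ ^ β` is not Lipschitz at the origin, hence the regularization by `ε`, uniform in `ε`.
theorem norm_deriv_norm_sq_add_rpow_le {ε : ℝ} (hβ : 0 ≤ β) (hβ₁ : β ≤ 1) (hε : 0 < ε) {t : ℝ}
    (hx : DifferentiableAt ℝ x t) :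
    ‖deriv (fun s => (‖x s‖ ^ 2 + ε) ^ (β / 2)) t‖ ≤ β * ‖x t‖ ^ (β - 1) * ‖deriv x t‖ := by
  rw [((hx.hasDerivAt.norm_sq.add_const ε).rpow_const (Or.inl (by positivity))).deriv]
  rcases eq_or_ne (x t) 0 with hxt | hxt
  · simp only [hxt, inner_zero_left, mul_zero, zero_mul, norm_zero]
    positivity
  have hr : 0 < ‖x t‖ := norm_pos_iff.2 hxt
  have hpow : (‖x t‖ ^ 2 + ε) ^ (β / 2 - 1) ≤ ‖x t‖ ^ (β - 2) := by
    rw [show β - 2 = (2 : ℕ) * (β / 2 - 1) by push_cast; ring, Real.rpow_mul hr.le,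
      Real.rpow_natCast]
    exact Real.rpow_le_rpow_of_nonpos (by positivity) (by linarith) (by linarith)
  have hsplit : ‖x t‖ ^ (β - 1) = ‖x t‖ * ‖x t‖ ^ (β - 2) := by
    rw [mul_comm, ← Real.rpow_add_one hr.ne']
    congr 1
    ring
  rw [norm_mul, norm_mul, norm_mul, Real.norm_ofNat,
    Real.norm_of_nonneg (by positivity : 0 ≤ β / 2),
    Real.norm_of_nonneg (by positivity : 0 ≤ (‖x t‖ ^ 2 + ε) ^ (β / 2 - 1)), hsplit]
  calc 2 * ‖inner ℝ (x t) (deriv x t)‖ * (β / 2) * (‖x t‖ ^ 2 + ε) ^ (β / 2 - 1)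
      ≤ 2 * (‖x t‖ * ‖deriv x t‖) * (β / 2) * ‖x t‖ ^ (β - 2) := by
        gcongr
        exact norm_inner_le_norm _ _
    _ = β * (‖x t‖ * ‖x t‖ ^ (β - 2)) * ‖deriv x t‖ := by ring

variable [FiniteDimensional ℝ E]

theorem enorm_norm_sq_add_rpow_sub_le_flatLength {ε : ℝ} (hβ : 0 ≤ β) (hβ₁ : β ≤ 1) (hε : 0 < ε)
    (hab : a ≤ b) (hx : AbsolutelyContinuousOnInterval x a b) :
    ‖(‖x b‖ ^ 2 + ε) ^ (β / 2) - (‖x a‖ ^ 2 + ε) ^ (β / 2)‖ₑ ≤ flatLength β a b x := by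
  have hsmooth : ContDiff ℝ 1 fun z : E => (‖z‖ ^ 2 + ε) ^ (β / 2) :=
    ((contDiff_norm_sq ℝ).add contDiff_const).rpow_const_of_ne fun z => by positivity
  refine (enorm_sub_le_lintegral_enorm_deriv hab
    (absolutelyContinuousOnInterval_comp_of_contDiff hsmooth hx)).trans (lintegral_mono_ae ?_)
  rw [ae_restrict_iff' measurableSet_Icc]
  filter_upwards [ae_differentiableAt_of_absolutelyContinuousOnInterval hx] with t ht hmem
  rw [← ofReal_norm]
  exact ENNReal.ofReal_le_ofReal
    (norm_deriv_norm_sq_add_rpow_le hβ hβ₁ hε (ht (uIcc_of_le hab ▸ hmem)))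

theorem enorm_norm_rpow_sub_le_flatLength (hβ : 0 ≤ β) (hβ₁ : β ≤ 1) (hab : a ≤ b)
    (hx : AbsolutelyContinuousOnInterval x a b) :
    ‖‖x b‖ ^ β - ‖x a‖ ^ β‖ₑ ≤ flatLength β a b x := by
  have hcont (r : ℝ) : Continuous fun ε : ℝ => (r ^ 2 + ε) ^ (β / 2) :=
    Continuous.rpow_const (by fun_prop) fun _ => Or.inr (by positivity)
  have hzero (r : ℝ) (hr : 0 ≤ r) : (r ^ 2 + 0) ^ (β / 2) = r ^ β := by
    rw [add_zero, ← Real.rpow_natCast, ← Real.rpow_mul hr]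
    congr 1
    push_cast
    ring
  have hlim := ((((hcont ‖x b‖).sub (hcont ‖x a‖)).enorm).tendsto 0).mono_left
    (nhdsWithin_le_nhds (s := Ioi 0))
  simp only [Pi.sub_apply, hzero _ (norm_nonneg _)] at hlim
  exact le_of_tendsto hlim (eventually_mem_nhdsWithin.mono fun ε hε =>
    enorm_norm_sq_add_rpow_sub_le_flatLength hβ hβ₁ hε hab hx)

theorem ofReal_norm_rpow_add_norm_rpow_le_flatLength_of_eq_zero (hβ : 0 < β) (hβ₁ : β ≤ 1)
    (hx : AbsolutelyContinuousOnInterval x a b) {t₀ : ℝ} (ht₀ : t₀ ∈ Icc a b) (hzero : x t₀ = 0) :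
    ENNReal.ofReal (‖x a‖ ^ β + ‖x b‖ ^ β) ≤ flatLength β a b x := by
  have hmem : t₀ ∈ uIcc a b := uIcc_of_le (ht₀.1.trans ht₀.2) ▸ ht₀
  have hleft := enorm_norm_rpow_sub_le_flatLength hβ.le hβ₁ ht₀.1
    (hx.mono (uIcc_subset_uIcc left_mem_uIcc hmem))
  have hright := enorm_norm_rpow_sub_le_flatLength hβ.le hβ₁ ht₀.2
    (hx.mono (uIcc_subset_uIcc hmem right_mem_uIcc))
  rw [hzero, norm_zero, Real.zero_rpow hβ.ne', zero_sub, enorm_neg,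
    Real.enorm_of_nonneg (by positivity)] at hleft
  rw [hzero, norm_zero, Real.zero_rpow hβ.ne', sub_zero,
    Real.enorm_of_nonneg (by positivity)] at hright
  rw [ENNReal.ofReal_add (by positivity) (by positivity),
    ← flatLength_add_flatLength ht₀.1 ht₀.2]
  exact add_le_add hleft hright

end FlatLength

section FlatChord

variable {β a b : ℝ} {x : ℝ → ℂ} {θ : ℝ → ℝ}

theorem norm_exp_sub_exp_of_im (β r φ ψ : ℝ) :
    ‖Complex.exp (β * (r + φ * Complex.I)) - Complex.exp (β * (r + ψ * Complex.I))‖ =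
      2 * Real.exp (β * r) * |Real.sin (β * (φ - ψ) / 2)| := by
  have hfactor : Complex.exp (β * (r + φ * Complex.I)) - Complex.exp (β * (r + ψ * Complex.I)) =
      Complex.exp (β * (r + ψ * Complex.I)) *
        (Complex.exp (Complex.I * (β * (φ - ψ) : ℝ)) - 1) := by
    rw [mul_sub, ← Complex.exp_add, mul_one]
    congr 2
    push_cast
    ring
  have hre : (β * (r + ψ * Complex.I) : ℂ).re = β * r := by simp
  rw [hfactor, norm_mul, Complex.norm_exp_I_mul_ofReal_sub_one, Complex.norm_exp, hre, norm_mul,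
    Real.norm_ofNat, Real.norm_eq_abs]
  ring

theorem norm_exp_sub_exp_of_abs_im_sub_eq_pi {z w : ℂ} (h : |z.im - w.im| = Real.pi) :
    ‖Complex.exp z - Complex.exp w‖ = Real.exp z.re + Real.exp w.re := by
  have hdir : Complex.exp (z.im * Complex.I) = -Complex.exp (w.im * Complex.I) := by
    rw [← sub_add_cancel z.im w.im, Complex.ofReal_add, add_mul, Complex.exp_add]
    rcases eq_or_eq_neg_of_abs_eq h with h | h
    · rw [h, Complex.exp_pi_mul_I, neg_one_mul]
    · rw [h, Complex.ofReal_neg, neg_mul, Complex.exp_neg_pi_mul_I, neg_one_mul]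
  have hpolar (z : ℂ) : Complex.exp z = Real.exp z.re * Complex.exp (z.im * Complex.I) := by
    rw [Complex.ofReal_exp, ← Complex.exp_add, Complex.re_add_im]
  rw [hpolar z, hpolar w, hdir, mul_neg, ← neg_add', norm_neg, ← add_mul, ← Complex.ofReal_add,
    norm_mul, Complex.norm_exp_ofReal_mul_I, mul_one, Complex.norm_real,
    Real.norm_of_nonneg (by positivity)]

theorem eq_exp_log_norm_add_mul_I {z : ℂ} {φ : ℝ} (hz : z ≠ 0)
    (hφ : z = ‖z‖ * Complex.exp (φ * Complex.I)) :
    z = Complex.exp (Real.log ‖z‖ + φ * Complex.I) := by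
  rwa [Complex.exp_add, ← Complex.ofReal_exp, Real.exp_log (norm_pos_iff.2 hz)]

theorem enorm_exp_mul_sub_exp_mul_le_flatLength {ℓ : ℝ → ℂ} (hβ : 0 ≤ β) (hab : a ≤ b)
    (hx : AbsolutelyContinuousOnInterval x a b) (hℓ : ContinuousOn ℓ (Icc a b))
    (hxℓ : EqOn x (fun t => Complex.exp (ℓ t)) (Icc a b)) :
    ‖Complex.exp (β * ℓ b) - Complex.exp (β * ℓ a)‖ₑ ≤ flatLength β a b x := by
  rw [← uIcc_of_le hab] at hℓ hxℓ
  have hℓac := absolutelyContinuousOnInterval_of_exp hℓ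
    (absolutelyContinuousOnInterval_congr hxℓ hx)
  have hpow : AbsolutelyContinuousOnInterval (fun t => Complex.exp (β * ℓ t)) a b :=
    absolutelyContinuousOnInterval_comp_of_contDiff (φ := fun z => Complex.exp (β * z))
      (by fun_prop) hℓac
  refine (enorm_sub_le_lintegral_enorm_deriv hab hpow).trans ?_
  simp only [flatLength, ← restrict_Ioo_eq_restrict_Icc]
  refine lintegral_mono_ae ((ae_restrict_iff' measurableSet_Ioo).2 ?_)
  filter_upwards [ae_differentiableAt_of_absolutelyContinuousOnInterval hℓac] with t ht hmem
  have hIoo : Ioo a b ⊆ uIcc a b := uIcc_of_le hab ▸ Ioo_subset_Icc_self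
  have hd := (ht (hIoo hmem)).hasDerivAt
  have hdx := ((hxℓ.mono hIoo).eventuallyEq_of_mem (isOpen_Ioo.mem_nhds hmem)).deriv_eq
  rw [hdx, hd.cexp.deriv, (hd.const_mul (β : ℂ)).cexp.deriv, hxℓ (hIoo hmem), ← ofReal_norm]
  refine ENNReal.ofReal_le_ofReal (le_of_eq ?_)
  simp only [norm_mul, Complex.norm_exp, Complex.re_ofReal_mul, Complex.norm_real,
    Real.norm_of_nonneg hβ]
  rw [← Real.exp_mul, mul_sub, mul_one, mul_comm _ β, Real.exp_sub]
  field_simp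

theorem enorm_exp_sub_exp_le_flatLength (hβ : 0 ≤ β) (hab : a ≤ b)
    (hx : AbsolutelyContinuousOnInterval x a b) (hx0 : ∀ t ∈ Icc a b, x t ≠ 0)
    (hθ : ContinuousOn θ (Icc a b))
    (hxθ : ∀ t ∈ Icc a b, x t = ‖x t‖ * Complex.exp (θ t * Complex.I)) :
    ‖Complex.exp (β * (Real.log ‖x b‖ + θ b * Complex.I)) -
      Complex.exp (β * (Real.log ‖x a‖ + θ a * Complex.I))‖ₑ ≤ flatLength β a b x := by
  refine enorm_exp_mul_sub_exp_mul_le_flatLength hβ hab hx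
    (ℓ := fun t => Real.log ‖x t‖ + θ t * Complex.I) ?_
    fun t ht => eq_exp_log_norm_add_mul_I (hx0 t ht) (hxθ t ht)
  have hxc : ContinuousOn x (Icc a b) := uIcc_of_le hab ▸ hx.continuousOn
  have hlog := hxc.norm.log fun t ht => norm_ne_zero_iff.2 (hx0 t ht)
  exact (Complex.continuous_ofReal.comp_continuousOn hlog).add
    ((Complex.continuous_ofReal.comp_continuousOn hθ).mul continuousOn_const)

theorem ofReal_chord_le_flatLength (hβ : 0 ≤ β) (hab : a ≤ b)
    (hx : AbsolutelyContinuousOnInterval x a b) (hx0 : ∀ t ∈ Icc a b, x t ≠ 0)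
    (hθ : ContinuousOn θ (Icc a b))
    (hxθ : ∀ t ∈ Icc a b, x t = ‖x t‖ * Complex.exp (θ t * Complex.I)) (hnorm : ‖x a‖ = ‖x b‖) :
    ENNReal.ofReal (2 * ‖x a‖ ^ β * |Real.sin (β * (θ b - θ a) / 2)|) ≤ flatLength β a b x := by
  have h := enorm_exp_sub_exp_le_flatLength hβ hab hx hx0 hθ hxθ
  rwa [← hnorm, ← ofReal_norm, norm_exp_sub_exp_of_im, mul_comm β (Real.log _),
    ← Real.rpow_def_of_pos (norm_pos_iff.2 (hx0 a (left_mem_Icc.2 hab)))] at h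

theorem exists_mem_Icc_mul_abs_sub_eq_pi (hab : a ≤ b) (hθ : ContinuousOn θ (Icc a b))
    (hwide : Real.pi ≤ β * |θ b - θ a|) : ∃ t ∈ Icc a b, β * |θ t - θ a| = Real.pi :=
  intermediate_value_Icc hab (continuousOn_const.mul (hθ.sub continuousOn_const).abs)
    ⟨by simpa using Real.pi_nonneg, hwide⟩

-- When the flat angle covered reaches `π`, the chord from the start passes through the apex; from
-- then on the radial variation suffices.
theorem ofReal_norm_rpow_add_norm_rpow_le_flatLength_of_pi_le (hβ : 0 ≤ β) (hβ₁ : β ≤ 1)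
    (hab : a ≤ b) (hx : AbsolutelyContinuousOnInterval x a b) (hx0 : ∀ t ∈ Icc a b, x t ≠ 0)
    (hθ : ContinuousOn θ (Icc a b))
    (hxθ : ∀ t ∈ Icc a b, x t = ‖x t‖ * Complex.exp (θ t * Complex.I))
    (hwide : Real.pi ≤ β * |θ b - θ a|) :
    ENNReal.ofReal (‖x a‖ ^ β + ‖x b‖ ^ β) ≤ flatLength β a b x := by
  obtain ⟨t, ht, hpi⟩ := exists_mem_Icc_mul_abs_sub_eq_pi hab hθ hwide
  have htu : t ∈ uIcc a b := uIcc_of_le hab ▸ ht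
  have hsub : Icc a t ⊆ Icc a b := Icc_subset_Icc_right ht.2
  have hleft := enorm_exp_sub_exp_le_flatLength hβ ht.1
    (hx.mono (uIcc_subset_uIcc left_mem_uIcc htu)) (fun s hs => hx0 s (hsub hs)) (hθ.mono hsub)
    fun s hs => hxθ s (hsub hs)
  have hright := enorm_norm_rpow_sub_le_flatLength hβ hβ₁ ht.2
    (hx.mono (uIcc_subset_uIcc htu right_mem_uIcc))
  have hexp (s : ℝ) (hs : s ∈ Icc a b) :
      Real.exp (β * (Real.log ‖x s‖ + θ s * Complex.I) : ℂ).re = ‖x s‖ ^ β := by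
    rw [Real.rpow_def_of_pos (norm_pos_iff.2 (hx0 s hs)), mul_comm (Real.log _)]
    simp
  rw [← ofReal_norm, norm_exp_sub_exp_of_abs_im_sub_eq_pi, hexp t ht,
    hexp a (left_mem_Icc.2 hab)] at hleft
  · rw [← flatLength_add_flatLength ht.1 ht.2]
    refine le_trans ?_ (add_le_add hleft hright)
    rw [← ofReal_norm, ← ENNReal.ofReal_add (by positivity) (by positivity), Real.norm_eq_abs]
    exact ENNReal.ofReal_le_ofReal (by linarith [le_abs_self (‖x b‖ ^ β - ‖x t‖ ^ β)])
  · rw [← hpi, ← abs_of_nonneg hβ, ← abs_mul, abs_of_nonneg hβ]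
    simp [mul_sub]

end FlatChord

namespace Kepler

section FlatLengthBound

variable {m α a b : ℝ} {x : ℝ → ℂ}

theorem potential_of_ne_zero (hα : 0 < α) {z : ℂ} (hz : z ≠ 0) :
    potential m α z = ENNReal.ofReal (m / (α * ‖z‖ ^ α)) := by
  have hz' : 0 < ‖z‖ := norm_pos_iff.2 hz
  rw [potential, ← ofReal_norm, ENNReal.ofReal_rpow_of_pos hz', ← ENNReal.ofReal_mul hα.le,
    ENNReal.ofReal_div_of_pos (by positivity)]

theorem aemeasurable_potential_comp (hx : ContinuousOn x (Icc a b)) :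
    AEMeasurable (fun t => potential m α (x t)) (volume.restrict (Icc a b)) :=
  (((hx.aemeasurable (μ := volume) measurableSet_Icc).enorm.pow_const _).const_mul _).const_div _

theorem ofReal_flat_speed_le (hm : 0 < m) (hα : 0 < α) (hα₂ : α < 2) (z v : ℂ) :
    ENNReal.ofReal ((1 - α / 2) * ‖z‖ ^ (1 - α / 2 - 1) * ‖v‖) ≤
      ENNReal.ofReal ((1 - α / 2) / √(m / α)) * (‖v‖ₑ * potential m α z ^ (2⁻¹ : ℝ)) := by
  have hexp : 1 - α / 2 - 1 = -(α / 2) := by ring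
  rcases eq_or_ne z 0 with rfl | hz
  · rw [norm_zero, Real.zero_rpow (by linarith), mul_zero, zero_mul, ENNReal.ofReal_zero]
    exact zero_le
  have hz' : 0 < ‖z‖ := norm_pos_iff.2 hz
  have hβ : 0 < 1 - α / 2 := by linarith
  rw [potential_of_ne_zero hα hz, ENNReal.ofReal_rpow_of_pos (by positivity), ← ofReal_norm,
    ← ENNReal.ofReal_mul (norm_nonneg _), ← ENNReal.ofReal_mul (by positivity)]
  refine ENNReal.ofReal_le_ofReal (le_of_eq ?_)
  rw [hexp, ← div_div, Real.div_rpow (by positivity) (by positivity), ← one_div,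
    ← Real.sqrt_eq_rpow (m / α), ← Real.rpow_mul hz'.le, Real.rpow_neg hz'.le, mul_one_div]
  field_simp

theorem sq_lintegral_mul_le {Ω : Type*} [MeasurableSpace Ω] {μ : Measure Ω} {f g : Ω → ℝ≥0∞}
    (hf : AEMeasurable f μ) (hg : AEMeasurable g μ) :
    (∫⁻ t, f t * g t ∂μ) ^ 2 ≤ (∫⁻ t, f t ^ 2 ∂μ) * ∫⁻ t, g t ^ 2 ∂μ := by
  have h := pow_le_pow_left' (ENNReal.lintegral_mul_le_Lp_mul_Lq μ .two_two hf hg) 2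
  simpa only [mul_pow, Pi.mul_apply, ← ENNReal.rpow_natCast, ← ENNReal.rpow_mul, Nat.cast_ofNat,
    one_div, inv_mul_cancel₀ (two_ne_zero' ℝ), ENNReal.rpow_one] using h

theorem lintegral_sq_enorm_deriv (a b : ℝ) (x : ℝ → ℂ) :
    ∫⁻ t in Icc a b, ‖deriv x t‖ₑ ^ 2 = 2 * kineticIntegral a b x := by
  rw [kineticIntegral, lintegral_const_mul' _ _ (by simp), ← mul_assoc,
    ENNReal.mul_inv_cancel (by simp) (by simp), one_mul]

theorem sq_flatLength_le_kineticIntegral_mul_potentialIntegral (hm : 0 < m) (hα : 0 < α)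
    (hα₂ : α < 2) (hx : ContinuousOn x (Icc a b)) :
    flatLength (1 - α / 2) a b x ^ 2 ≤ ENNReal.ofReal (2 * α * (1 - α / 2) ^ 2 / m) *
      (kineticIntegral a b x * potentialIntegral m α a b x) := by
  have hc : 0 ≤ (1 - α / 2) / √(m / α) := div_nonneg (by linarith) (Real.sqrt_nonneg _)
  have hconst : ENNReal.ofReal (2 * α * (1 - α / 2) ^ 2 / m) =
      ENNReal.ofReal ((1 - α / 2) / √(m / α)) ^ 2 * 2 := by
    rw [← ENNReal.ofReal_pow hc, ← ENNReal.ofReal_ofNat, ← ENNReal.ofReal_mul (sq_nonneg _),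
      div_pow, Real.sq_sqrt (by positivity)]
    congr 1
    field_simp
  have hsq (y : ℝ≥0∞) : (y ^ (2⁻¹ : ℝ)) ^ 2 = y := by
    rw [← ENNReal.rpow_natCast, ← ENNReal.rpow_mul, Nat.cast_ofNat,
      inv_mul_cancel₀ two_ne_zero, ENNReal.rpow_one]
  have hlength : flatLength (1 - α / 2) a b x ≤ ENNReal.ofReal ((1 - α / 2) / √(m / α)) *
      ∫⁻ t in Icc a b, ‖deriv x t‖ₑ * potential m α (x t) ^ (2⁻¹ : ℝ) := by
    rw [← lintegral_const_mul' _ _ ENNReal.ofReal_ne_top]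
    exact lintegral_mono fun t => ofReal_flat_speed_le hm hα hα₂ _ _
  have hcauchy := sq_lintegral_mul_le (μ := volume.restrict (Icc a b))
    (measurable_deriv x).enorm.aemeasurable
    ((aemeasurable_potential_comp (m := m) (α := α) hx).pow_const (2⁻¹ : ℝ))
  simp only [hsq, lintegral_sq_enorm_deriv] at hcauchy
  calc flatLength (1 - α / 2) a b x ^ 2
      ≤ ENNReal.ofReal ((1 - α / 2) / √(m / α)) ^ 2 *
          (2 * kineticIntegral a b x * potentialIntegral m α a b x) := by
        refine (pow_le_pow_left' hlength 2).trans ?_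
        rw [mul_pow]
        gcongr
        exact hcauchy
    _ = _ := by rw [hconst]; ring

end FlatLengthBound

section LowerBound

variable {m α φm φp T S : ℝ} {x : ℝ → ℂ}

theorem mu_pos (hm : 0 < m) (hα : 0 < α) : 0 < mu m α :=
  mul_pos (by linarith) (Real.sqrt_pos.2 (by positivity))

/-- The distance `|x̄(±T)|` of the endpoints from the origin. -/
def radius (m α T : ℝ) : ℝ := (mu m α * T) ^ (2 / (α + 2))

theorem radius_pos (hm : 0 < m) (hα : 0 < α) (hT : 0 < T) : 0 < radius m α T :=
  Real.rpow_pos_of_pos (mul_pos (mu_pos hm hα) hT) _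

theorem norm_xbar (hm : 0 < m) (hα : 0 < α) (φm φp t : ℝ) :
    ‖xbar m α φm φp t‖ = radius m α |t| := by
  have := mu_pos hm hα
  rw [xbar, norm_mul, Complex.norm_exp_ofReal_mul_I, mul_one, Complex.norm_real,
    Real.norm_of_nonneg (by positivity), radius]

/-- Half the angle between the images of the two endpoints on the cone `z ^ (1 - α / 2)`, cut off
at `π / 2`: from there on the geodesic between them runs through the apex. -/
def flatHalfAngle (α φm φp : ℝ) : ℝ := min ((1 - α / 2) * |φp - φm| / 2) (Real.pi / 2)

/-- Half the zero-energy action needed to traverse the base of an isosceles triangle in the flat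
coordinate `z ^ (1 - α / 2)`, whose legs have length `|x̄(±T)| ^ (1 - α / 2)` and enclose the angle
`2 γ` at the origin. -/
def halfAction (m α T γ : ℝ) : ℝ :=
  radius m α T ^ (1 - α / 2) * Real.sin γ * √(2 * m / α) / (1 - α / 2)

theorem halfAction_strictMonoOn (hm : 0 < m) (hα : 0 < α) (hα₂ : α < 2) (hT : 0 < T) :
    StrictMonoOn (halfAction m α T) (Icc 0 (Real.pi / 2)) := by
  intro γ hγ γ' hγ' hlt
  have hR := radius_pos hm hα hT
  have hβ : 0 < 1 - α / 2 := by linarith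
  have hsin : Real.sin γ < Real.sin γ' :=
    Real.sin_lt_sin_of_lt_of_le_pi_div_two (by linarith [hγ.1, Real.pi_pos]) hγ'.2 hlt
  unfold halfAction
  gcongr

theorem sq_halfAction (hm : 0 < m) (hα : 0 < α) (T γ : ℝ) :
    halfAction m α T γ ^ 2 = (2 * radius m α T ^ (1 - α / 2) * Real.sin γ) ^ 2 /
      (2 * α * (1 - α / 2) ^ 2 / m) := by
  rw [halfAction, div_pow, mul_pow, Real.sq_sqrt (by positivity)]
  field_simp

theorem ofReal_le_flatLength_of_mem_Gamma (hm : 0 < m) (hα : 0 < α) (hα₂ : α < 2) (hT : 0 < T)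
    (hS : 0 < S) (hx : x ∈ Gamma m α φm φp T S) :
    ENNReal.ofReal (2 * radius m α T ^ (1 - α / 2) * Real.sin (flatHalfAngle α φm φp)) ≤
      flatLength (1 - α / 2) (-S) S x := by
  have hab : -S ≤ S := by linarith
  have hβ : 0 < 1 - α / 2 := by linarith
  have hβ₁ : 1 - α / 2 ≤ 1 := by linarith
  obtain ⟨hl, hr⟩ := endpoints_of_mem_Gamma hS hx
  have hnl : ‖x (-S)‖ = radius m α T := by rw [hl, norm_xbar hm hα, abs_neg, abs_of_pos hT]
  have hnr : ‖x S‖ = radius m α T := by rw [hr, norm_xbar hm hα, abs_of_pos hT]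
  have hR : 0 ≤ radius m α T ^ (1 - α / 2) := Real.rpow_nonneg (radius_pos hm hα hT).le _
  have hsum : 2 * radius m α T ^ (1 - α / 2) * Real.sin (flatHalfAngle α φm φp) ≤
      ‖x (-S)‖ ^ (1 - α / 2) + ‖x S‖ ^ (1 - α / 2) := by
    rw [hnl, hnr, ← two_mul]
    exact mul_le_of_le_one_right (by positivity) (Real.sin_le_one _)
  by_cases hx0 : ∀ t ∈ Icc (-S) S, x t ≠ 0
  · obtain ⟨-, -, -, -, θ, hθ, hxθ, rfl, rfl⟩ := mem_GammaStar_of_mem_Gamma hS hx hx0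
    rcases le_total Real.pi ((1 - α / 2) * |θ S - θ (-S)|) with hwide | hnarrow
    · exact (ENNReal.ofReal_le_ofReal hsum).trans
        (ofReal_norm_rpow_add_norm_rpow_le_flatLength_of_pi_le hβ.le hβ₁ hab hx.1.1 hx0 hθ hxθ
          hwide)
    · have habs : |(1 - α / 2) * (θ S - θ (-S)) / 2| = (1 - α / 2) * |θ S - θ (-S)| / 2 := by
        rw [abs_div, abs_mul, abs_of_pos hβ, abs_two]
      have hangle : flatHalfAngle α (θ (-S)) (θ S) = (1 - α / 2) * |θ S - θ (-S)| / 2 :=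
        min_eq_left (by linarith)
      have hchord := ofReal_chord_le_flatLength hβ.le hab hx.1.1 hx0 hθ hxθ (hnl.trans hnr.symm)
      rwa [hnl, Real.abs_sin_eq_sin_abs_of_abs_le_pi (by linarith [Real.pi_pos]), habs,
        ← hangle] at hchord
  · push Not at hx0
    obtain ⟨t₀, ht₀, hzero⟩ := hx0
    exact (ENNReal.ofReal_le_ofReal hsum).trans
      (ofReal_norm_rpow_add_norm_rpow_le_flatLength_of_eq_zero hβ hβ₁ hx.1.1 ht₀ hzero)

theorem flatHalfAngle_mem_Icc (hα₂ : α < 2) : flatHalfAngle α φm φp ∈ Icc 0 (Real.pi / 2) := by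
  have hβ : 0 < 1 - α / 2 := by linarith
  exact ⟨le_min (by positivity) (by positivity), min_le_right _ _⟩

theorem ofReal_sq_halfAction_le_maupertuis (hm : 0 < m) (hα : 0 < α) (hα₂ : α < 2) (hT : 0 < T)
    (hS : 0 < S) (hx : x ∈ Gamma m α φm φp T S) :
    ENNReal.ofReal (halfAction m α T (flatHalfAngle α φm φp) ^ 2) ≤ maupertuis m α S x := by
  have hβ : 0 < 1 - α / 2 := by linarith
  have hR := radius_pos hm hα hT
  have hγ := flatHalfAngle_mem_Icc (φm := φm) (φp := φp) hα₂
  have hsin : 0 ≤ Real.sin (flatHalfAngle α φm φp) :=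
    Real.sin_nonneg_of_nonneg_of_le_pi hγ.1 (by linarith [hγ.2, Real.pi_pos])
  rw [sq_halfAction hm hα, ENNReal.ofReal_div_of_pos (by positivity),
    ENNReal.ofReal_pow (by positivity)]
  refine ENNReal.div_le_of_le_mul' ?_
  exact (pow_le_pow_left' (ofReal_le_flatLength_of_mem_Gamma hm hα hα₂ hT hS hx) 2).trans
    (sq_flatLength_le_kineticIntegral_mul_potentialIntegral hm hα hα₂
      (hx.1.continuousOn (by linarith)))

theorem action_eq_add (m α S : ℝ) (x : ℝ → ℂ) :
    action m α S x = kineticIntegral (-S) S x + potentialIntegral m α (-S) S x :=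
  lintegral_add_left ((measurable_deriv x).enorm.pow_const 2 |>.const_mul _) _

theorem ofReal_two_mul_le_add_of_sq_le_mul {c : ℝ} {K P : ℝ≥0∞}
    (h : ENNReal.ofReal (c ^ 2) ≤ K * P) : ENNReal.ofReal (2 * c) ≤ K + P := by
  rcases eq_or_ne K ⊤ with rfl | hK
  · rw [top_add]
    exact le_top
  rcases eq_or_ne P ⊤ with rfl | hP
  · rw [add_top]
    exact le_top
  lift K to NNReal using hK
  lift P to NNReal using hP
  rw [← ENNReal.coe_mul, ENNReal.ofReal_le_coe, NNReal.coe_mul] at h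
  rw [← ENNReal.coe_add, ENNReal.ofReal_le_coe, NNReal.coe_add]
  exact le_of_sq_le_sq (by nlinarith [sq_nonneg ((K : ℝ) - P)]) (by positivity)

theorem ofReal_two_mul_halfAction_le_action (hm : 0 < m) (hα : 0 < α) (hα₂ : α < 2) (hT : 0 < T)
    (hS : 0 < S) (hx : x ∈ Gamma m α φm φp T S) :
    ENNReal.ofReal (2 * halfAction m α T (flatHalfAngle α φm φp)) ≤ action m α S x := by
  rw [action_eq_add]
  exact ofReal_two_mul_le_add_of_sq_le_mul
    (ofReal_sq_halfAction_le_maupertuis hm hα hα₂ hT hS hx)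

end LowerBound

end Kepler

theorem exists_leftInverse_integral_hasDerivAt_inv {q : ℝ → ℝ} (hq : Continuous q) {q₀ : ℝ}
    (hq₀ : 0 < q₀) (hle : ∀ s, q₀ ≤ q s) :
    ∃ u : ℝ → ℝ, (∀ s, u (∫ σ in (0 : ℝ)..s, q σ) = s) ∧ ∀ t, HasDerivAt u (q (u t))⁻¹ t := by
  set h : ℝ → ℝ := fun s => ∫ σ in (0 : ℝ)..s, q σ
  have hd (s : ℝ) : HasDerivAt h (q s) s := hq.integral_hasStrictDerivAt 0 s |>.hasDerivAt
  have hpos (s : ℝ) : 0 < q s := hq₀.trans_le (hle s)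
  have hmono : StrictMono h := strictMono_of_deriv_pos fun s => by rw [(hd s).deriv]; exact hpos s
  have hlin : Monotone fun s => h s - q₀ * s := by
    have hd' (s : ℝ) : HasDerivAt (fun s => h s - q₀ * s) (q s - q₀) s := by
      simpa only [mul_one] using (hd s).fun_sub ((hasDerivAt_id' s).const_mul q₀)
    exact monotone_of_deriv_nonneg (fun s => (hd' s).differentiableAt) fun s => by
      rw [(hd' s).deriv]
      exact sub_nonneg.2 (hle s)
  have hh0 : h 0 - q₀ * 0 = 0 := by simp [h]
  have htop : Tendsto h atTop atTop :=
    tendsto_atTop_mono' _ ((eventually_ge_atTop 0).mono fun s hs =>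
      sub_nonneg.1 (hh0 ▸ hlin hs)) (tendsto_id.const_mul_atTop hq₀)
  have hbot : Tendsto h atBot atBot :=
    tendsto_atBot_mono' _ ((eventually_le_atBot 0).mono fun s hs =>
      sub_nonpos.1 (hh0 ▸ hlin hs)) (tendsto_id.const_mul_atBot hq₀)
  have hcont : Continuous h := continuous_iff_continuousAt.2 fun s => (hd s).continuousAt
  let e := hmono.orderIsoOfSurjective h (hcont.surjective htop hbot)
  exact ⟨e.symm, e.symm_apply_apply, fun t =>
    HasDerivAt.of_local_left_inverse e.symm.continuous.continuousAt (hd _) (hpos _).ne'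
      (.of_forall e.apply_symm_apply)⟩

theorem exists_segment_hasDerivAt {c k s : ℝ} (d : ℝ) (hc : 0 < c) (hk : 0 < k) (hs : s ≤ 0) :
    ∃ S : ℝ, 0 < S ∧ ∃ u : ℝ → ℝ, u (-S) = -1 ∧ u S = 1 ∧
      ∀ t, HasDerivAt u (k * ‖c + (d * u t : ℝ) * Complex.I‖ ^ s) t := by
  set q : ℝ → ℝ := fun σ => k⁻¹ * ‖c + (d * σ : ℝ) * Complex.I‖ ^ (-s)
  have hcle (σ : ℝ) : c ≤ ‖c + (d * σ : ℝ) * Complex.I‖ := by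
    simpa using Complex.re_le_norm (c + (d * σ : ℝ) * Complex.I)
  have hq : Continuous q := continuous_const.mul
    (Continuous.rpow_const (by fun_prop) fun σ => Or.inl (hc.trans_le (hcle σ)).ne')
  have hqle (σ : ℝ) : k⁻¹ * c ^ (-s) ≤ q σ :=
    mul_le_mul_of_nonneg_left (Real.rpow_le_rpow hc.le (hcle σ) (by linarith)) (by positivity)
  have heven (σ : ℝ) : q (-σ) = q σ := by
    simp only [q, ← Complex.norm_conj (c + (d * σ : ℝ) * Complex.I)]
    simp
  obtain ⟨u, huinv, hu⟩ := exists_leftInverse_integral_hasDerivAt_inv hq (by positivity) hqle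
  have hodd : ∫ σ in (0 : ℝ)..-1, q σ = -∫ σ in (0 : ℝ)..1, q σ := by
    have h := intervalIntegral.integral_comp_neg (a := 0) (b := 1) q
    simp only [heven, neg_zero] at h
    rw [h, intervalIntegral.integral_symm]
  refine ⟨∫ σ in (0 : ℝ)..1, q σ,
    intervalIntegral.intervalIntegral_pos_of_pos (hq.intervalIntegrable 0 1)
      (fun σ => lt_of_lt_of_le (by positivity) (hqle σ)) one_pos, u, ?_, huinv 1, fun t => ?_⟩
  · rw [← hodd, huinv]
  · have h := hu t
    rwa [mul_inv, inv_inv, ← Real.rpow_neg (norm_nonneg _), neg_neg] at h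

section ConePower

variable {N : ℝ} {p q : ℂ} {w : ℝ → ℂ} {t : ℝ}

theorem cpow_mul_conj_cpow {z : ℂ} (hz : z ∈ Complex.slitPlane) (s : ℝ) :
    z ^ (s : ℂ) * (starRingEnd ℂ z) ^ (s : ℂ) = (‖z‖ ^ (2 * s) : ℝ) := by
  rw [Complex.conj_cpow _ _ (Complex.mem_slitPlane_iff_arg.1 hz).1, Complex.conj_ofReal,
    Complex.mul_conj, Complex.normSq_eq_norm_sq, Complex.norm_cpow_real, mul_comm 2,
    Real.rpow_mul (norm_nonneg _), Real.rpow_two]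

theorem conj_mem_slitPlane {z : ℂ} (hz : z ∈ Complex.slitPlane) :
    starRingEnd ℂ z ∈ Complex.slitPlane := by
  simpa [Complex.mem_slitPlane_iff] using hz

theorem hasDerivAt_comp_cpow (hw : w t ∈ Complex.slitPlane) {w' : ℂ} (hderiv : HasDerivAt w w' t)
    (s : ℂ) : HasDerivAt (fun t => w t ^ s) (s * w t ^ (s - 1) * w') t :=
  (Complex.hasStrictDerivAt_cpow_const hw).hasDerivAt.comp t hderiv

-- Since `|w| ^ (2 * s) = w ^ s * conj w ^ s`, the factor `w ^ (N - 1)` cancels for this choice of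
-- the speed of `w`.
theorem hasDerivAt_mul_cpow (hw : w t ∈ Complex.slitPlane)
    (hderiv : HasDerivAt w ((‖w t‖ ^ (2 * (1 - N)) : ℝ) * q) t) :
    HasDerivAt (fun s => p * w s ^ (N : ℂ))
      (p * N * q * (starRingEnd ℂ (w t)) ^ ((1 - N : ℝ) : ℂ)) t := by
  refine ((hasDerivAt_comp_cpow hw hderiv N).const_mul p).congr_deriv ?_
  have hcancel : w t ^ ((N : ℂ) - 1) * w t ^ ((1 - N : ℝ) : ℂ) = 1 := by
    rw [← Complex.cpow_add _ _ (Complex.slitPlane_ne_zero hw), Complex.ofReal_sub,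
      Complex.ofReal_one, sub_add_sub_cancel', sub_self, Complex.cpow_zero]
  rw [← cpow_mul_conj_cpow hw]
  linear_combination p * N * q * (starRingEnd ℂ (w t)) ^ ((1 - N : ℝ) : ℂ) * hcancel

theorem hasDerivAt_mul_conj_cpow (hw : w t ∈ Complex.slitPlane)
    (hderiv : HasDerivAt w ((‖w t‖ ^ (2 * (1 - N)) : ℝ) * q) t) :
    HasDerivAt (fun s => p * N * q * (starRingEnd ℂ (w s)) ^ ((1 - N : ℝ) : ℂ))
      (-(N * (N - 1) * ‖q‖ ^ 2 * ‖w t‖ ^ (2 - 4 * N) : ℝ) * (p * w t ^ (N : ℂ))) t := by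
  have hconj : HasDerivAt (fun s => starRingEnd ℂ (w s))
      ((‖w t‖ ^ (2 * (1 - N)) : ℝ) * starRingEnd ℂ q) t := by
    refine hderiv.star.congr_deriv ?_
    rw [star_mul', ← starRingEnd_apply, Complex.conj_ofReal, starRingEnd_apply]
  refine ((hasDerivAt_comp_cpow (w := fun s => starRingEnd ℂ (w s)) (conj_mem_slitPlane hw) hconj
    _).const_mul _).congr_deriv ?_
  have hnorm : ((‖w t‖ ^ (2 - 4 * N) : ℝ) : ℂ) = (‖w t‖ ^ (2 * (1 - N)) : ℝ) *
      (w t ^ ((-N : ℝ) : ℂ) * starRingEnd ℂ (w t) ^ ((-N : ℝ) : ℂ)) := by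
    rw [cpow_mul_conj_cpow hw, ← Complex.ofReal_mul,
      ← Real.rpow_add (norm_pos_iff.2 (Complex.slitPlane_ne_zero hw))]
    congr 2
    ring
  have hcancel : w t ^ (N : ℂ) * w t ^ (-N : ℂ) = 1 := by
    rw [← Complex.cpow_add _ _ (Complex.slitPlane_ne_zero hw), add_neg_cancel, Complex.cpow_zero]
  have hexp : ((1 - N : ℝ) : ℂ) - 1 = (-N : ℝ) := by push_cast; ring
  rw [hexp, Complex.ofReal_mul _ (_ ^ _), hnorm, Complex.ofReal_mul, Complex.ofReal_pow,
    ← Complex.mul_conj']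
  push_cast
  linear_combination p * N * (N - 1) * q * starRingEnd ℂ q *
    ((‖w t‖ ^ (2 * (1 - N)) : ℝ) : ℂ) * starRingEnd ℂ (w t) ^ (-N : ℂ) * hcancel

end ConePower

theorem lintegral_Icc_ofReal_of_hasDerivAt_of_nonneg {a b : ℝ} {g g' : ℝ → ℝ} (hab : a ≤ b)
    (hg : ContinuousOn g (Icc a b)) (hderiv : ∀ t ∈ Ioo a b, HasDerivAt g (g' t) t)
    (hpos : ∀ t ∈ Ioo a b, 0 ≤ g' t) :
    ∫⁻ t in Icc a b, ENNReal.ofReal (g' t) = ENNReal.ofReal (g b - g a) := by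
  have hint := intervalIntegral.integrableOn_deriv_of_nonneg hg hderiv hpos
  have hftc := intervalIntegral.integral_eq_sub_of_hasDerivAt_of_le hab hg hderiv
    ((intervalIntegrable_iff_integrableOn_Ioc_of_le hab).2 hint)
  rw [← hftc, intervalIntegral.integral_of_le hab, ← restrict_Ioo_eq_restrict_Icc,
    ← restrict_Ioo_eq_restrict_Ioc]
  refine (ofReal_integral_eq_lintegral_ofReal (hint.mono_set Ioo_subset_Ioc_self) ?_).symm
  exact (ae_restrict_iff' measurableSet_Ioo).2 (.of_forall hpos)

namespace Kepler

section Energy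

variable {m α a b : ℝ} {x : ℝ → ℂ}

theorem inv_two_mul_enorm_sq (z : ℂ) : 2⁻¹ * ‖z‖ₑ ^ 2 = ENNReal.ofReal (‖z‖ ^ 2 / 2) := by
  rw [← ofReal_norm, ← ENNReal.ofReal_pow (norm_nonneg z), div_eq_inv_mul,
    ENNReal.ofReal_mul (by norm_num), ENNReal.ofReal_inv_of_pos two_pos, ENNReal.ofReal_ofNat]

theorem kineticIntegral_eq_ofReal_sub {g : ℝ → ℝ} (hab : a ≤ b) (hg : ContinuousOn g (Icc a b))
    (hderiv : ∀ t ∈ Ioo a b, HasDerivAt g (‖deriv x t‖ ^ 2 / 2) t) :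
    kineticIntegral a b x = ENNReal.ofReal (g b - g a) := by
  simp only [kineticIntegral, inv_two_mul_enorm_sq]
  exact lintegral_Icc_ofReal_of_hasDerivAt_of_nonneg hab hg hderiv fun t _ => by positivity

theorem potentialIntegral_eq_kineticIntegral (hα : 0 < α)
    (henergy : ∀ᵐ t ∂volume.restrict (Icc a b),
      x t ≠ 0 ∧ ‖deriv x t‖ ^ 2 / 2 - m / (α * ‖x t‖ ^ α) = 0) :
    potentialIntegral m α a b x = kineticIntegral a b x := by
  refine lintegral_congr_ae (henergy.mono fun t ht => ?_)
  simp only [inv_two_mul_enorm_sq, potential_of_ne_zero hα ht.1, sub_eq_zero.1 ht.2]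

theorem IsZeroEnergySolution.potentialIntegral_eq (hα : 0 < α)
    (hx : IsZeroEnergySolution m α a b x) :
    potentialIntegral m α a b x = kineticIntegral a b x := by
  obtain ⟨v, hv⟩ := hx
  refine potentialIntegral_eq_kineticIntegral hα ?_
  rw [← restrict_Ioo_eq_restrict_Icc]
  refine (ae_restrict_iff' measurableSet_Ioo).2 (.of_forall fun t ht => ?_)
  obtain ⟨hx0, hxv, -, henergy⟩ := hv t (Ioo_subset_Icc_self ht)
  refine ⟨hx0, ?_⟩
  rwa [(hxv.hasDerivAt (Icc_mem_nhds ht.1 ht.2)).deriv]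

theorem memH1_of_norm_deriv_le {F : ℝ → ℝ} {s : Set ℝ} (hs : s.Countable) (hab : a ≤ b)
    (hx : ContinuousOn x (Icc a b)) (hd : ∀ t ∈ Icc a b \ s, DifferentiableAt ℝ x t)
    (hF : MemLp F 2 (volume.restrict (Icc a b)))
    (hle : ∀ t ∈ Icc a b \ s, ‖deriv x t‖ ≤ F t) : MemH1 a b x := by
  have hmem : MemLp (deriv x) 2 (volume.restrict (Icc a b)) := by
    refine hF.mono' (measurable_deriv x).aestronglyMeasurable ?_
    filter_upwards [ae_restrict_mem measurableSet_Icc,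
      ae_restrict_of_ae (hs.ae_notMem volume)] with t ht hts using hle t ⟨ht, hts⟩
  rw [← uIcc_of_le hab] at hx hd
  refine ⟨absolutelyContinuousOnInterval_of_hasDerivAt_off_countable hs hx
    (fun t ht => (hd t ht).hasDerivAt) ?_, hmem⟩
  exact (intervalIntegrable_iff_integrableOn_Icc_of_le hab).2 (hmem.integrable one_le_two)

end Energy

section ConePower

variable {m α N : ℝ} {p q : ℂ} {w : ℝ → ℂ}

theorem isZeroEnergySolution_mul_cpow (hα : 0 < α) (hp : ‖p‖ = 1) (hN : N * (1 - α / 2) = 1)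
    (hq : α * N ^ 2 * ‖q‖ ^ 2 = 2 * m) (hw : ∀ t, w t ∈ Complex.slitPlane)
    (hderiv : ∀ t, HasDerivAt w ((‖w t‖ ^ (2 * (1 - N)) : ℝ) * q) t) (a b : ℝ) :
    IsZeroEnergySolution m α a b (fun t => p * w t ^ (N : ℂ)) := by
  refine ⟨fun t => p * N * q * (starRingEnd ℂ (w t)) ^ ((1 - N : ℝ) : ℂ), fun t _ => ?_⟩
  have hw0 := Complex.slitPlane_ne_zero (hw t)
  have hpos : 0 < ‖w t‖ := norm_pos_iff.2 hw0
  have hnorm (s : ℝ) : ‖p * w t ^ (N : ℂ)‖ ^ s = ‖w t‖ ^ (N * s) := by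
    rw [norm_mul, hp, one_mul, Complex.norm_cpow_real, Real.rpow_mul hpos.le]
  refine ⟨?_, (hasDerivAt_mul_cpow (hw t) (hderiv t)).hasDerivWithinAt,
    ((hasDerivAt_mul_conj_cpow (hw t) (hderiv t)).congr_deriv ?_).hasDerivWithinAt, ?_⟩
  · have hp0 : p ≠ 0 := norm_pos_iff.1 (hp ▸ one_pos)
    exact mul_ne_zero hp0 (by simp [Complex.cpow_eq_zero_iff, hw0])
  · have hm : m = N * (N - 1) * ‖q‖ ^ 2 := by
      linear_combination (-1 / 2 : ℝ) * hq - N * ‖q‖ ^ 2 * hN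
    rw [hnorm, div_eq_mul_inv, ← Real.rpow_neg hpos.le, hm, Complex.real_smul,
      show -(N * (α + 2)) = 2 - 4 * N by linear_combination 2 * hN, Complex.ofReal_neg]
  · rw [hnorm, norm_mul, norm_mul, norm_mul, hp, one_mul, Complex.norm_cpow_real,
      Complex.norm_conj, Complex.norm_real, Real.norm_eq_abs, mul_pow, mul_pow, sq_abs,
      ← Real.rpow_natCast (_ ^ _), ← Real.rpow_mul hpos.le,
      show (1 - N) * (2 : ℕ) = -(N * α) by push_cast; linear_combination -2 * hN,
      Real.rpow_neg hpos.le]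
    field_simp
    linear_combination hq

theorem mul_cpow_eq_norm_mul_exp (φ N : ℝ) {z : ℂ} (hz : z ≠ 0) :
    Complex.exp (φ * Complex.I) * z ^ (N : ℂ) = ‖Complex.exp (φ * Complex.I) * z ^ (N : ℂ)‖ *
      Complex.exp ((φ + N * z.arg : ℝ) * Complex.I) := by
  rw [norm_mul, Complex.norm_exp_ofReal_mul_I, one_mul, Complex.norm_cpow_real,
    Real.rpow_def_of_pos (norm_pos_iff.2 hz), Complex.cpow_def_of_ne_zero hz, Complex.ofReal_exp,
    ← Complex.exp_add, ← Complex.exp_add, Complex.log]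
  congr 1
  push_cast
  ring

end ConePower

end Kepler

theorem exists_chord_hasDerivAt {ρ γ κ s : ℝ} (hρ : 0 < ρ) (hγ : |γ| < Real.pi / 2)
    (hsin : Real.sin γ ≠ 0) (hκ : 0 < κ) (hs : s ≤ 0) :
    ∃ S : ℝ, 0 < S ∧ ∃ w : ℝ → ℂ, ∃ q : ℂ, ‖q‖ = κ ∧
      inner ℝ q (w S - w (-S)) = 2 * κ * (ρ * |Real.sin γ|) ∧
      w (-S) = ρ * Complex.exp ((-γ : ℝ) * Complex.I) ∧ w S = ρ * Complex.exp (γ * Complex.I) ∧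
      (∀ t, w t ∈ Complex.slitPlane) ∧ ∀ t, HasDerivAt w ((‖w t‖ ^ s : ℝ) * q) t := by
  have hc : 0 < ρ * Real.cos γ := mul_pos hρ (Real.cos_pos_of_mem_Ioo (abs_lt.1 hγ))
  set d := ρ * Real.sin γ with hd
  have hd_abs : |d| = ρ * |Real.sin γ| := by rw [hd, abs_mul, abs_of_pos hρ]
  have hd₀ : 0 < |d| := abs_pos.2 (mul_ne_zero hρ.ne' hsin)
  obtain ⟨S, hS, u, hul, hur, hu⟩ :=
    exists_segment_hasDerivAt (k := κ / |d|) d hc (by positivity) hs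
  refine ⟨S, hS, fun t => (ρ * Real.cos γ : ℝ) + (d * u t : ℝ) * Complex.I,
    (κ / |d| * d : ℝ) * Complex.I, ?_, ?_, ?_, ?_, fun t => Or.inl ?_, fun t => ?_⟩
  · rw [norm_mul, Complex.norm_I, mul_one, Complex.norm_real, Real.norm_eq_abs, abs_mul,
      abs_of_pos (by positivity : 0 < κ / |d|), div_mul_cancel₀ _ hd₀.ne']
  · have hchord : ((d * u S : ℝ) * Complex.I - (d * u (-S) : ℝ) * Complex.I : ℂ) =
        (2 * d) • Complex.I := by
      rw [hul, hur, Complex.real_smul]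
      push_cast
      ring
    rw [add_sub_add_left_eq_sub, hchord, ← Complex.real_smul, real_inner_smul_left,
      real_inner_smul_right, real_inner_self_eq_norm_sq, Complex.norm_I, ← hd_abs]
    field_simp
    rw [sq_abs]
  · simp only [hul, Complex.exp_mul_I, ← Complex.ofReal_cos, ← Complex.ofReal_sin, Real.cos_neg,
      Real.sin_neg, hd]
    push_cast
    ring
  · simp only [hur, Complex.exp_mul_I, ← Complex.ofReal_cos, ← Complex.ofReal_sin, hd]
    push_cast
    ring
  · simpa only [Complex.add_re, Complex.ofReal_re, Complex.re_ofReal_mul, Complex.I_re, mul_zero,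
      add_zero] using hc
  · refine ((((hu t).const_mul d).ofReal_comp.mul_const Complex.I).const_add _).congr_deriv ?_
    push_cast
    ring

namespace Kepler

section ConePower

variable {N a b : ℝ} {p q : ℂ} {w : ℝ → ℂ}

theorem memH1_mul_cpow (hab : a ≤ b) (hw : ∀ t, w t ∈ Complex.slitPlane)
    (hderiv : ∀ t, HasDerivAt w ((‖w t‖ ^ (2 * (1 - N)) : ℝ) * q) t) :
    MemH1 a b (fun t => p * w t ^ (N : ℂ)) := by
  have hd (t : ℝ) := hasDerivAt_mul_cpow (p := p) (hw t) (hderiv t)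
  have hv : Continuous fun t => p * N * q * (starRingEnd ℂ (w t)) ^ ((1 - N : ℝ) : ℂ) :=
    continuous_iff_continuousAt.2 fun t =>
      (hasDerivAt_mul_conj_cpow (hw t) (hderiv t)).continuousAt
  obtain ⟨C, hC⟩ := isCompact_Icc.exists_bound_of_continuousOn (hv.continuousOn (s := Icc a b))
  refine memH1_of_norm_deriv_le countable_empty hab
    (fun t _ => (hd t).continuousAt.continuousWithinAt) (fun t _ => (hd t).differentiableAt)
    (memLp_const C) fun t ht => ?_
  rw [(hd t).deriv]
  exact hC t ht.1

theorem kineticIntegral_mul_cpow (hab : a ≤ b) (hp : ‖p‖ = 1)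
    (hw : ∀ t, w t ∈ Complex.slitPlane)
    (hderiv : ∀ t, HasDerivAt w ((‖w t‖ ^ (2 * (1 - N)) : ℝ) * q) t) :
    kineticIntegral a b (fun t => p * w t ^ (N : ℂ)) =
      ENNReal.ofReal (N ^ 2 / 2 * inner ℝ q (w b - w a)) := by
  have hg (t : ℝ) : HasDerivAt (fun t => N ^ 2 / 2 * inner ℝ q (w t))
      (‖deriv (fun t => p * w t ^ (N : ℂ)) t‖ ^ 2 / 2) t := by
    refine (((innerSL ℝ q).hasFDerivAt.comp_hasDerivAt t (hderiv t)).const_mul _).congr_deriv ?_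
    rw [(hasDerivAt_mul_cpow (hw t) (hderiv t)).deriv, innerSL_apply_apply, ← Complex.real_smul,
      real_inner_smul_right, real_inner_self_eq_norm_sq, norm_mul, norm_mul, norm_mul, hp,
      Complex.norm_cpow_real, Complex.norm_conj, Complex.norm_real, mul_pow,
      ← Real.rpow_two (_ ^ _), ← Real.rpow_mul (norm_nonneg _), mul_pow, mul_pow,
      Real.norm_eq_abs, sq_abs, mul_comm (1 - N)]
    ring
  rw [kineticIntegral_eq_ofReal_sub hab (fun t _ => (hg t).continuousAt.continuousWithinAt)
    fun t _ => hg t, inner_sub_right, mul_sub]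

end ConePower

section Chord

variable {m α φm φp T S : ℝ} {x : ℝ → ℂ}

theorem xbar_of_pos (hT : 0 < T) :
    xbar m α φm φp T = radius m α T * Complex.exp (φp * Complex.I) := by
  rw [xbar, abs_of_pos hT, if_pos hT.le, radius]

theorem xbar_of_neg (hT : T < 0) :
    xbar m α φm φp T = radius m α (-T) * Complex.exp (φm * Complex.I) := by
  rw [xbar, abs_of_neg hT, if_neg hT.not_ge, radius]

theorem mem_GammaStar_of_norm_of_angle {θ : ℝ → ℝ} (hT : 0 < T) (hS : 0 ≤ S)
    (hx : MemH1 (-S) S x) (hx0 : ∀ t ∈ Icc (-S) S, x t ≠ 0) (hθ : ContinuousOn θ (Icc (-S) S))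
    (hpolar : ∀ t ∈ Icc (-S) S, x t = ‖x t‖ * Complex.exp (θ t * Complex.I))
    (hnl : ‖x (-S)‖ = radius m α T) (hnr : ‖x S‖ = radius m α T) (hθl : θ (-S) = φm)
    (hθr : θ S = φp) : x ∈ GammaStar m α φm φp T S := by
  refine ⟨hx, hx0, ?_, ?_, θ, hθ, hpolar, hθl, hθr⟩
  · rw [hpolar _ (left_mem_Icc.2 (by linarith)), hnl, hθl, xbar_of_neg (neg_lt_zero.2 hT), neg_neg]
  · rw [hpolar _ (right_mem_Icc.2 (by linarith)), hnr, hθr, xbar_of_pos hT]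

theorem arg_mul_exp {ρ γ : ℝ} (hρ : 0 < ρ) (hγ : |γ| < Real.pi) :
    (ρ * Complex.exp (γ * Complex.I)).arg = γ := by
  obtain ⟨hl, hr⟩ := abs_lt.1 hγ
  rw [Complex.exp_mul_I, Complex.arg_mul_cos_add_sin_mul_I hρ ⟨hl, hr.le⟩]

theorem mul_cpow_mem_GammaStar {w : ℝ → ℂ} {q : ℂ} {ρ γ φ N : ℝ} (hT : 0 < T) (hS : 0 ≤ S)
    (hρ : 0 < ρ) (hρN : ρ ^ N = radius m α T) (hγ : |γ| < Real.pi) (hl : φ - N * γ = φm)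
    (hr : φ + N * γ = φp) (hwl : w (-S) = ρ * Complex.exp ((-γ : ℝ) * Complex.I))
    (hwr : w S = ρ * Complex.exp (γ * Complex.I)) (hw : ∀ t, w t ∈ Complex.slitPlane)
    (hderiv : ∀ t, HasDerivAt w ((‖w t‖ ^ (2 * (1 - N)) : ℝ) * q) t) :
    (fun t => Complex.exp (φ * Complex.I) * w t ^ (N : ℂ)) ∈ GammaStar m α φm φp T S := by
  have hw0 (t : ℝ) := Complex.slitPlane_ne_zero (hw t)
  have hnorm {t θ : ℝ} (h : w t = ρ * Complex.exp (θ * Complex.I)) :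
      ‖Complex.exp (φ * Complex.I) * w t ^ (N : ℂ)‖ = radius m α T := by
    rw [norm_mul, Complex.norm_exp_ofReal_mul_I, one_mul, Complex.norm_cpow_real, h, norm_mul,
      Complex.norm_exp_ofReal_mul_I, mul_one, Complex.norm_of_nonneg hρ.le, hρN]
  refine mem_GammaStar_of_norm_of_angle (θ := fun t => φ + N * (w t).arg) hT hS
    (memH1_mul_cpow (by linarith) hw hderiv) (fun t _ => ?_) (fun t _ => ?_)
    (fun t _ => mul_cpow_eq_norm_mul_exp φ N (hw0 t)) (hnorm hwl) (hnorm hwr) ?_ ?_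
  · exact mul_ne_zero (Complex.exp_ne_zero _) (by simp [Complex.cpow_eq_zero_iff, hw0])
  · exact (((Complex.continuousAt_arg (hw t)).comp (hderiv t).continuousAt).const_mul N).const_add φ
      |>.continuousWithinAt
  · rw [hwl, arg_mul_exp hρ (by rwa [abs_neg]), ← hl]
    ring
  · rw [hwr, arg_mul_exp hρ hγ, hr]

theorem exists_isZeroEnergySolution_mem_GammaStar (hm : 0 < m) (hα : 0 < α) (hα₂ : α < 2)
    (hT : 0 < T) (hΔ₀ : 0 < |φp - φm|) (hΔ : (1 - α / 2) * |φp - φm| < Real.pi) :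
    ∃ S : ℝ, 0 < S ∧ ∃ x ∈ GammaStar m α φm φp T S, IsZeroEnergySolution m α (-S) S x ∧
      kineticIntegral (-S) S x = ENNReal.ofReal (halfAction m α T (flatHalfAngle α φm φp)) := by
  have hangle : flatHalfAngle α φm φp = (1 - α / 2) * |φp - φm| / 2 := min_eq_left (by linarith)
  have hβ : 0 < 1 - α / 2 := by linarith
  have hβ₁ : 1 - α / 2 < 1 := by linarith
  rw [halfAction, hangle]
  set β := 1 - α / 2
  set N := β⁻¹ with hN_def
  have hN : 1 < N := (one_lt_inv₀ hβ).2 hβ₁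
  have hNβ : N * β = 1 := inv_mul_cancel₀ hβ.ne'
  set γ := β * (φp - φm) / 2
  have hγ_abs : |γ| = β * |φp - φm| / 2 := by rw [abs_div, abs_mul, abs_of_pos hβ, abs_two]
  have hγ₀ : 0 < |γ| := hγ_abs ▸ by positivity
  have hsin_abs : |Real.sin γ| = Real.sin |γ| :=
    Real.abs_sin_eq_sin_abs_of_abs_le_pi (by linarith)
  have hsin : 0 < |Real.sin γ| := hsin_abs ▸ Real.sin_pos_of_pos_of_lt_pi hγ₀ (by linarith)
  have hR := radius_pos hm hα hT
  set ρ := radius m α T ^ β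
  have hρN : ρ ^ N = radius m α T := Real.rpow_rpow_inv hR.le hβ.ne'
  have hκ : 0 < √(2 * m / α) / N := div_pos (Real.sqrt_pos.2 (by positivity)) (by linarith)
  obtain ⟨S, hS, w, q, hq, hchord, hwl, hwr, hw, hderiv⟩ := exists_chord_hasDerivAt
    (ρ := ρ) (s := 2 * (1 - N)) (by positivity) (by linarith) (abs_pos.1 hsin) hκ (by linarith)
  have hp := Complex.norm_exp_ofReal_mul_I ((φp + φm) / 2)
  refine ⟨S, hS, _, mul_cpow_mem_GammaStar hT hS.le (by positivity) hρN (by linarith) ?_ ?_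
    hwl hwr hw hderiv, isZeroEnergySolution_mul_cpow hα hp hNβ ?_ hw hderiv _ _, ?_⟩
  · linear_combination (-(φp - φm) / 2) * hNβ
  · linear_combination ((φp - φm) / 2) * hNβ
  · rw [hq, div_pow, Real.sq_sqrt (by positivity)]
    field_simp
  · rw [kineticIntegral_mul_cpow (by linarith) hp hw hderiv, hchord, ← hγ_abs, ← hsin_abs, hN_def]
    congr 1
    field_simp

end Chord

end Kepler

theorem lintegral_Icc_comp_mul_left {c : ℝ} (hc : 0 < c) (f : ℝ → ℝ≥0∞) (a b : ℝ) :
    ∫⁻ t in Icc (c * a) (c * b), f t = ENNReal.ofReal c * ∫⁻ t in Icc a b, f (c * t) := by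
  have hderiv (t : ℝ) : HasDerivAt (fun t => c * t) c t := by
    simpa only [mul_one] using (hasDerivAt_id' t).const_mul c
  rw [← lintegral_const_mul' _ _ ENNReal.ofReal_ne_top, ← image_mul_left_Icc' hc,
    lintegral_image_eq_lintegral_abs_deriv_mul measurableSet_Icc
      (fun t _ => (hderiv t).hasDerivWithinAt) (mul_right_injective₀ hc.ne').injOn, abs_of_pos hc]

theorem image_mul_left_uIoc {c : ℝ} (hc : 0 < c) (a b : ℝ) :
    (fun t => c * t) '' uIoc a b = uIoc (c * a) (c * b) := by
  rw [uIoc, uIoc, ← mul_min_of_nonneg _ _ hc.le, ← mul_max_of_nonneg _ _ hc.le,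
    image_mul_left_Ioc hc]

theorem absolutelyContinuousOnInterval_comp_mul_left {X : Type*} [PseudoMetricSpace X]
    {f : ℝ → X} {a b c : ℝ} (hc : 0 < c) (hf : AbsolutelyContinuousOnInterval f (c * a) (c * b)) :
    AbsolutelyContinuousOnInterval (fun t => f (c * t)) a b := by
  rw [absolutelyContinuousOnInterval_iff] at hf ⊢
  intro ε hε
  obtain ⟨δ, hδ, h⟩ := hf ε hε
  refine ⟨δ / c, by positivity, fun E hE hlen => ?_⟩
  refine h (E.1, fun i => (c * (E.2 i).1, c * (E.2 i).2)) ⟨fun i hi => ?_, ?_⟩ ?_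
  · simp only [← image_const_mul_uIcc]
    exact ⟨mem_image_of_mem _ (hE.1 i hi).1, mem_image_of_mem _ (hE.1 i hi).2⟩
  · intro i hi j hj hij
    simp only [Function.onFun, ← image_mul_left_uIoc hc]
    exact (disjoint_image_iff (mul_right_injective₀ hc.ne')).2 (hE.2 hi hj hij)
  · simp only [Real.dist_eq, ← mul_sub, abs_mul, abs_of_pos hc, ← Finset.mul_sum] at hlen ⊢
    exact (lt_div_iff₀' hc).1 hlen

namespace Kepler

section TimeScaling

variable {m α φm φp T S a b c : ℝ} {x : ℝ → ℂ}

theorem kineticIntegral_comp_mul_left (hc : 0 < c) (x : ℝ → ℂ) (a b : ℝ) :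
    kineticIntegral a b (fun t => x (c * t)) =
      ENNReal.ofReal c * kineticIntegral (c * a) (c * b) x := by
  have hsq (t : ℝ) : 2⁻¹ * ‖deriv (fun t => x (c * t)) t‖ₑ ^ 2 =
      ENNReal.ofReal c * (ENNReal.ofReal c * (2⁻¹ * ‖deriv x (c * t)‖ₑ ^ 2)) := by
    rw [deriv_comp_mul_left, enorm_smul, Real.enorm_of_nonneg hc.le]
    ring
  simp only [kineticIntegral, hsq, lintegral_const_mul' _ _ ENNReal.ofReal_ne_top,
    lintegral_Icc_comp_mul_left hc]

theorem potentialIntegral_eq_mul_comp_mul_left (hc : 0 < c) (m α : ℝ) (x : ℝ → ℂ) (a b : ℝ) :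
    potentialIntegral m α (c * a) (c * b) x =
      ENNReal.ofReal c * potentialIntegral m α a b (fun t => x (c * t)) :=
  lintegral_Icc_comp_mul_left hc _ a b

theorem maupertuis_comp_mul_left (hc : 0 < c) (m α S : ℝ) (x : ℝ → ℂ) :
    maupertuis m α S (fun t => x (c * t)) = maupertuis m α (c * S) x := by
  rw [maupertuis, maupertuis, kineticIntegral_comp_mul_left hc, ← mul_neg,
    potentialIntegral_eq_mul_comp_mul_left hc]
  ring

theorem memLp_deriv_iff_kineticIntegral_lt_top :
    MemLp (deriv x) 2 (volume.restrict (Icc a b)) ↔ kineticIntegral a b x < ∞ := by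
  have hmeas := (measurable_deriv x).aestronglyMeasurable (μ := volume.restrict (Icc a b))
  rw [MemLp, and_iff_right hmeas,
    eLpNorm_lt_top_iff_lintegral_rpow_enorm_lt_top two_ne_zero ENNReal.ofNat_ne_top,
    ENNReal.toReal_ofNat]
  simp only [ENNReal.rpow_ofNat, lintegral_sq_enorm_deriv]
  exact ⟨fun h => (le_mul_of_one_le_left' one_le_two).trans_lt h,
    ENNReal.mul_lt_top ENNReal.ofNat_lt_top⟩

theorem memH1_comp_mul_left (hc : 0 < c) (hx : MemH1 (c * a) (c * b) x) :
    MemH1 a b (fun t => x (c * t)) := by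
  refine ⟨absolutelyContinuousOnInterval_comp_mul_left hc hx.1, ?_⟩
  rw [memLp_deriv_iff_kineticIntegral_lt_top, kineticIntegral_comp_mul_left hc]
  exact ENNReal.mul_lt_top ENNReal.ofReal_lt_top (memLp_deriv_iff_kineticIntegral_lt_top.1 hx.2)

theorem comp_mul_left_mem_GammaStar (hc : 0 < c) (hx : x ∈ GammaStar m α φm φp T (c * S)) :
    (fun t => x (c * t)) ∈ GammaStar m α φm φp T S := by
  obtain ⟨hH1, hx0, hl, hr, θ, hθ, hpolar, hθl, hθr⟩ := hx
  rw [← mul_neg] at hH1 hx0 hl hθ hpolar hθl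
  have hmaps : MapsTo (fun t => c * t) (Icc (-S) S) (Icc (c * -S) (c * S)) := fun t ht =>
    ⟨mul_le_mul_of_nonneg_left ht.1 hc.le, mul_le_mul_of_nonneg_left ht.2 hc.le⟩
  exact ⟨memH1_comp_mul_left hc hH1, fun t ht => hx0 _ (hmaps ht), hl, hr, fun t => θ (c * t),
    hθ.comp (by fun_prop) hmaps, fun t ht => hpolar _ (hmaps ht), hθl, hθr⟩

end TimeScaling

section RadialSolution

variable {m α t : ℝ}

/-- The speed of the collision-ejection solution `x̄` at the times `±t`, given by zero energy. -/
def radialSpeed (m α t : ℝ) : ℝ := √(2 * m / α) * radius m α t ^ (-(α / 2))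

theorem radius_zero (hα : 0 < α) : radius m α 0 = 0 := by
  rw [radius, mul_zero, Real.zero_rpow (by positivity)]

theorem continuous_radius (hα : 0 < α) : Continuous (radius m α) :=
  (continuous_const.mul continuous_id).rpow_const fun _ => Or.inr (by positivity)

theorem radius_monotoneOn (hm : 0 < m) (hα : 0 < α) : MonotoneOn (radius m α) (Ici 0) :=
  fun _ hs _ _ hst => Real.rpow_le_rpow (mul_nonneg (mu_pos hm hα).le hs)
    (mul_le_mul_of_nonneg_left hst (mu_pos hm hα).le) (by positivity)

theorem radialSpeed_eq (hm : 0 < m) (hα : 0 < α) (ht : 0 < t) :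
    radialSpeed m α t = mu m α * (2 / (α + 2)) * (mu m α * t) ^ (2 / (α + 2) - 1) := by
  have hμt : 0 < mu m α * t := mul_pos (mu_pos hm hα) ht
  have hsqrt : √(2 * m / α) = 2 * √(m / (2 * α)) := by
    rw [← Real.sqrt_sq zero_le_two, ← Real.sqrt_mul (sq_nonneg 2), Real.sqrt_sq zero_le_two]
    congr 1
    field_simp
  have hexp : 2 / (α + 2) * -(α / 2) = 2 / (α + 2) - 1 := by
    field_simp
    ring
  rw [radialSpeed, radius, ← Real.rpow_mul hμt.le, hexp, hsqrt, mu]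
  field_simp

theorem hasDerivAt_radius (hm : 0 < m) (hα : 0 < α) (ht : 0 < t) :
    HasDerivAt (radius m α) (radialSpeed m α t) t := by
  have hμt : 0 < mu m α * t := mul_pos (mu_pos hm hα) ht
  rw [radialSpeed_eq hm hα ht]
  have hlinear : HasDerivAt (fun t => mu m α * t) (mu m α) t := by
    simpa only [mul_one] using (hasDerivAt_id' t).const_mul (mu m α)
  exact hlinear.rpow_const (Or.inl hμt.ne')

theorem radius_eq_mul_radialSpeed (hm : 0 < m) (hα : 0 < α) (ht : 0 < t) :
    radius m α t = (α + 2) / 2 * t * radialSpeed m α t := by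
  have hμt : 0 < mu m α * t := mul_pos (mu_pos hm hα) ht
  have := mu_pos hm hα
  rw [radialSpeed_eq hm hα ht, Real.rpow_sub_one hμt.ne', radius]
  field_simp

theorem radialSpeed_pos (hm : 0 < m) (hα : 0 < α) (ht : 0 < t) : 0 < radialSpeed m α t := by
  have := radius_pos hm hα ht
  unfold radialSpeed
  positivity

theorem radialSpeed_antitoneOn (hm : 0 < m) (hα : 0 < α) :
    AntitoneOn (radialSpeed m α) (Ioi 0) := by
  intro s hs t ht hst
  have hle := radius_monotoneOn hm hα (Ioi_subset_Ici_self hs) (Ioi_subset_Ici_self ht) hst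
  exact mul_le_mul_of_nonneg_left (Real.rpow_le_rpow_of_nonpos (radius_pos hm hα hs) hle
    (by linarith)) (Real.sqrt_nonneg _)

theorem sq_radialSpeed_div_two (hm : 0 < m) (hα : 0 < α) (ht : 0 < t) :
    radialSpeed m α t ^ 2 / 2 = m / (α * radius m α t ^ α) := by
  have hr := radius_pos hm hα ht
  rw [radialSpeed, mul_pow, Real.sq_sqrt (by positivity), ← Real.rpow_natCast (_ ^ _),
    ← Real.rpow_mul hr.le, show -(α / 2) * (2 : ℕ) = -α by push_cast; ring, Real.rpow_neg hr.le]
  field_simp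

theorem hasDerivAt_halfAction_pi_div_two (hm : 0 < m) (hα : 0 < α) (hα₂ : α < 2) (ht : 0 < t) :
    HasDerivAt (fun t => halfAction m α t (Real.pi / 2)) (radialSpeed m α t ^ 2) t := by
  have hr := radius_pos hm hα ht
  have hβ : 1 - α / 2 ≠ 0 := by linarith
  refine (((((hasDerivAt_radius hm hα ht).rpow_const (p := 1 - α / 2) (Or.inl hr.ne')).mul_const
    _).mul_const _).div_const _).congr_deriv ?_
  rw [Real.sin_pi_div_two, show 1 - α / 2 - 1 = -(α / 2) by ring, sq,
    mul_one, mul_comm (radialSpeed m α t), mul_div_right_comm, mul_assoc, mul_div_cancel_left₀ _ hβ]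
  nth_rw 3 [radialSpeed]
  ring

theorem continuous_halfAction (hα : 0 < α) (hα₂ : α < 2) (γ : ℝ) :
    Continuous fun t => halfAction m α t γ :=
  ((((continuous_radius hα).rpow_const fun _ => Or.inr (by linarith)).mul_const _).mul_const
    _).div_const _

theorem halfAction_zero (hα : 0 < α) (hα₂ : α < 2) (γ : ℝ) : halfAction m α 0 γ = 0 := by
  rw [halfAction, radius_zero hα, Real.zero_rpow (by linarith), zero_mul, zero_mul, zero_div]

end RadialSolution

section CollisionEjection

variable {m α φm φp T t : ℝ}

theorem hasDerivAt_xbar (hm : 0 < m) (hα : 0 < α) (φm φp : ℝ) (ht : t ≠ 0) :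
    HasDerivAt (xbar m α φm φp) ((radialSpeed m α |t| * SignType.sign t : ℝ) *
      Complex.exp ((if 0 ≤ t then φp else φm : ℝ) * Complex.I)) t := by
  have hradius : HasDerivAt (fun s => radius m α |s|) (radialSpeed m α |t| * SignType.sign t) t :=
    (hasDerivAt_radius hm hα (abs_pos.2 ht)).comp t (hasDerivAt_abs ht)
  refine (hradius.ofReal_comp.mul_const _).congr_of_eventuallyEq ?_
  rcases ht.lt_or_gt with h | h
  · filter_upwards [Iio_mem_nhds h] with s hs
    rw [xbar, if_neg (not_le.2 hs), if_neg (not_le.2 h), radius]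
  · filter_upwards [Ioi_mem_nhds h] with s hs
    rw [xbar, if_pos (le_of_lt hs), if_pos h.le, radius]

theorem norm_deriv_xbar (hm : 0 < m) (hα : 0 < α) (φm φp : ℝ) (ht : t ≠ 0) :
    ‖deriv (xbar m α φm φp) t‖ = radialSpeed m α |t| := by
  have hsign : |(SignType.sign t : ℝ)| = 1 := by
    rcases ht.lt_or_gt with h | h <;> simp [h]
  rw [(hasDerivAt_xbar hm hα φm φp ht).deriv, norm_mul, Complex.norm_exp_ofReal_mul_I, mul_one,
    Complex.norm_real, Real.norm_eq_abs, abs_mul, hsign, mul_one,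
    abs_of_pos (radialSpeed_pos hm hα (abs_pos.2 ht))]

theorem continuous_xbar (hm : 0 < m) (hα : 0 < α) (φm φp : ℝ) :
    Continuous (xbar m α φm φp) := by
  refine continuous_iff_continuousAt.2 fun t => ?_
  rcases eq_or_ne t 0 with rfl | ht
  · have hnorm : Tendsto (fun t => ‖xbar m α φm φp t‖) (𝓝 0) (𝓝 0) := by
      have hradius : Continuous fun t => radius m α |t| :=
        (continuous_radius hα).comp continuous_abs
      simpa only [norm_xbar hm hα, abs_zero, radius_zero hα] using hradius.tendsto 0
    have hzero : xbar m α φm φp 0 = 0 := by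
      rw [← norm_eq_zero, norm_xbar hm hα, abs_zero, radius_zero hα]
    rw [ContinuousAt, hzero]
    exact tendsto_zero_iff_norm_tendsto_zero.2 hnorm
  · exact (hasDerivAt_xbar hm hα φm φp ht).continuousAt

theorem kineticIntegral_add {a b c : ℝ} (hab : a ≤ b) (hbc : b ≤ c) (x : ℝ → ℂ) :
    kineticIntegral a b x + kineticIntegral b c x = kineticIntegral a c x := by
  simp only [kineticIntegral, ← restrict_Ioc_eq_restrict_Icc]
  rw [← lintegral_union measurableSet_Ioc (Ioc_disjoint_Ioc_of_le le_rfl),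
    Ioc_union_Ioc_eq_Ioc hab hbc]

theorem kineticIntegral_xbar (hm : 0 < m) (hα : 0 < α) (hα₂ : α < 2) (hT : 0 < T) :
    kineticIntegral (-T) T (xbar m α φm φp) = ENNReal.ofReal (halfAction m α T (Real.pi / 2)) := by
  have hcont := continuous_halfAction (m := m) hα hα₂ (Real.pi / 2)
  have hincoming : kineticIntegral (-T) 0 (xbar m α φm φp) =
      ENNReal.ofReal (halfAction m α T (Real.pi / 2) / 2) := by
    rw [kineticIntegral_eq_ofReal_sub (g := fun t => -halfAction m α (-t) (Real.pi / 2) / 2)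
      (by linarith) (by fun_prop) fun t ht => ?_]
    · simp only [neg_neg, neg_zero, halfAction_zero hα hα₂]
      ring_nf
    · rw [norm_deriv_xbar hm hα φm φp ht.2.ne, abs_of_neg ht.2]
      have hderiv := (hasDerivAt_halfAction_pi_div_two hm hα hα₂ (neg_pos.2 ht.2)).comp t
        (hasDerivAt_neg t)
      exact (hderiv.neg.div_const 2).congr_deriv (by rw [mul_neg_one, neg_neg])
  have houtgoing : kineticIntegral 0 T (xbar m α φm φp) =
      ENNReal.ofReal (halfAction m α T (Real.pi / 2) / 2) := by
    rw [kineticIntegral_eq_ofReal_sub (g := fun t => halfAction m α t (Real.pi / 2) / 2)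
      hT.le (by fun_prop) fun t ht => ?_]
    · simp only [halfAction_zero hα hα₂, zero_div, sub_zero]
    · rw [norm_deriv_xbar hm hα φm φp ht.1.ne', abs_of_pos ht.1]
      exact (hasDerivAt_halfAction_pi_div_two hm hα hα₂ ht.1).div_const 2
  rw [← kineticIntegral_add (by linarith) hT.le, hincoming, houtgoing, ← two_mul,
    ← ENNReal.ofReal_ofNat 2, ← ENNReal.ofReal_mul (by norm_num),
    mul_div_cancel₀ _ two_ne_zero]

theorem potentialIntegral_xbar (hm : 0 < m) (hα : 0 < α) (a b : ℝ) :
    potentialIntegral m α a b (xbar m α φm φp) = kineticIntegral a b (xbar m α φm φp) := by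
  refine potentialIntegral_eq_kineticIntegral hα (ae_restrict_of_ae ?_)
  filter_upwards [Measure.ae_ne volume 0] with t ht
  have hnorm := norm_xbar hm hα φm φp t
  refine ⟨norm_pos_iff.1 (hnorm ▸ radius_pos hm hα (abs_pos.2 ht)), ?_⟩
  rw [hnorm, norm_deriv_xbar hm hα φm φp ht, sq_radialSpeed_div_two hm hα (abs_pos.2 ht),
    sub_self]

theorem memLp_deriv_xbar (hm : 0 < m) (hα : 0 < α) (hα₂ : α < 2) (hT : 0 < T) :
    MemLp (deriv (xbar m α φm φp)) 2 (volume.restrict (Icc (-T) T)) := by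
  rw [memLp_deriv_iff_kineticIntegral_lt_top, kineticIntegral_xbar hm hα hα₂ hT]
  exact ENNReal.ofReal_lt_top

theorem memH1_xbar (hm : 0 < m) (hα : 0 < α) (hα₂ : α < 2) (hT : 0 < T) :
    MemH1 (-T) T (xbar m α φm φp) :=
  memH1_of_norm_deriv_le (countable_singleton 0) (by linarith)
    (continuous_xbar hm hα φm φp).continuousOn
    (fun _ ht => (hasDerivAt_xbar hm hα φm φp ht.2).differentiableAt)
    (memLp_deriv_xbar hm hα hα₂ hT).norm fun _ _ => le_rfl

end CollisionEjection

section RoundedCollision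

variable {m α φm φp δ T t : ℝ}

/-- A curve that follows `x̄` for `|t| ≥ δ` and runs through an arc of a circle around the origin
for `|t| ≤ δ`, used to approximate `x̄` by collision-free curves. -/
def roundedXbar (m α φm φp δ t : ℝ) : ℂ :=
  radius m α (max |t| δ) *
    Complex.exp (((φp + φm) / 2 + (φp - φm) / 2 * max (-1) (min 1 (t / δ)) : ℝ) * Complex.I)

theorem norm_roundedXbar (hm : 0 < m) (hα : 0 < α) (hδ : 0 < δ) (t : ℝ) :
    ‖roundedXbar m α φm φp δ t‖ = radius m α (max |t| δ) := by
  rw [roundedXbar, norm_mul, Complex.norm_exp_ofReal_mul_I, mul_one, Complex.norm_real,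
    Real.norm_of_nonneg (radius_pos hm hα (lt_max_of_lt_right hδ)).le]

theorem continuous_roundedXbar (hα : 0 < α) : Continuous (roundedXbar m α φm φp δ) := by
  have := continuous_radius (m := m) hα
  unfold roundedXbar
  fun_prop

theorem max_min_div_eq_one (hδ : 0 < δ) (ht : δ ≤ t) : max (-1) (min 1 (t / δ)) = 1 := by
  rw [min_eq_left ((one_le_div hδ).2 ht), max_eq_right (by norm_num)]

theorem max_min_div_eq_neg_one (hδ : 0 < δ) (ht : t ≤ -δ) :
    max (-1) (min 1 (t / δ)) = -1 := by
  have hdiv : t / δ ≤ -1 := by rwa [div_le_iff₀ hδ, neg_one_mul]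
  rw [min_eq_right (by linarith), max_eq_left hdiv]

theorem roundedXbar_eq_xbar (hδ : 0 < δ) (ht : δ ≤ |t|) :
    roundedXbar m α φm φp δ t = xbar m α φm φp t := by
  rw [roundedXbar, max_eq_left ht]
  rcases le_abs'.1 ht with h | h
  · rw [xbar_of_neg (by linarith), abs_of_neg (by linarith), max_min_div_eq_neg_one hδ h]
    ring_nf
  · rw [xbar_of_pos (by linarith), abs_of_pos (by linarith), max_min_div_eq_one hδ h]
    ring_nf

theorem roundedXbar_eventuallyEq_xbar (hδ : 0 < δ) (ht : δ < |t|) :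
    roundedXbar m α φm φp δ =ᶠ[𝓝 t] xbar m α φm φp := by
  filter_upwards [continuous_abs.continuousAt.eventually (lt_mem_nhds ht)] with s hs
    using roundedXbar_eq_xbar hδ hs.le

theorem hasDerivAt_roundedXbar_of_abs_lt (hδ : 0 < δ) (ht : |t| < δ) :
    HasDerivAt (roundedXbar m α φm φp δ) (radius m α δ *
      (Complex.exp (((φp + φm) / 2 + (φp - φm) / 2 * (t / δ) : ℝ) * Complex.I) *
        (((φp - φm) / 2 * (1 / δ) : ℝ) * Complex.I))) t := by
  have hangle : HasDerivAt (fun s => (φp + φm) / 2 + (φp - φm) / 2 * (s / δ))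
      ((φp - φm) / 2 * (1 / δ)) t :=
    (((hasDerivAt_id t).div_const δ).const_mul _).const_add _
  refine ((hangle.ofReal_comp.mul_const Complex.I).cexp.const_mul
    (radius m α δ : ℂ)).congr_of_eventuallyEq ?_
  filter_upwards [continuous_abs.continuousAt.eventually (gt_mem_nhds ht)] with s hs
  obtain ⟨hs₁, hs₂⟩ := abs_lt.1 hs
  have hlow : -1 ≤ s / δ := by rw [le_div_iff₀ hδ]; linarith
  rw [roundedXbar, max_eq_right hs.le, min_eq_right ((div_le_one hδ).2 hs₂.le), max_eq_right hlow]

theorem differentiableAt_roundedXbar (hm : 0 < m) (hα : 0 < α) (hδ : 0 < δ) (htδ : |t| ≠ δ) :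
    DifferentiableAt ℝ (roundedXbar m α φm φp δ) t := by
  rcases htδ.lt_or_gt with h | h
  · exact (hasDerivAt_roundedXbar_of_abs_lt hδ h).differentiableAt
  · exact (hasDerivAt_xbar hm hα φm φp
      (abs_pos.1 (hδ.trans h))).differentiableAt.congr_of_eventuallyEq
        (roundedXbar_eventuallyEq_xbar hδ h)

theorem norm_deriv_roundedXbar_le (hm : 0 < m) (hα : 0 < α) (hδ : 0 < δ) (ht : t ≠ 0)
    (htδ : |t| ≠ δ) : ‖deriv (roundedXbar m α φm φp δ) t‖ ≤
      (1 + (α + 2) / 4 * |φp - φm|) * ‖deriv (xbar m α φm φp) t‖ := by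
  have ht' : 0 < |t| := abs_pos.2 ht
  rw [norm_deriv_xbar hm hα φm φp ht]
  have hspeed := radialSpeed_pos hm hα ht'
  rcases htδ.lt_or_gt with h | h
  · have hnorm : ‖deriv (roundedXbar m α φm φp δ) t‖ =
        radius m α δ * (|φp - φm| / 2 * (1 / δ)) := by
      rw [(hasDerivAt_roundedXbar_of_abs_lt hδ h).deriv, norm_mul, norm_mul, norm_mul,
        Complex.norm_exp_ofReal_mul_I, Complex.norm_I, Complex.norm_real, Complex.norm_real,
        Real.norm_of_nonneg (radius_pos hm hα hδ).le, one_mul, mul_one, Real.norm_eq_abs, abs_mul,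
        abs_div, abs_two, abs_of_pos (one_div_pos.2 hδ)]
    calc ‖deriv (roundedXbar m α φm φp δ) t‖
        = (α + 2) / 4 * |φp - φm| * radialSpeed m α δ := by
          rw [hnorm, radius_eq_mul_radialSpeed hm hα hδ]
          field_simp
          ring
      _ ≤ (1 + (α + 2) / 4 * |φp - φm|) * radialSpeed m α |t| := by
          gcongr ?_ * ?_
          · exact (radialSpeed_pos hm hα hδ).le
          · linarith
          · exact radialSpeed_antitoneOn hm hα ht' hδ h.le
  · rw [(roundedXbar_eventuallyEq_xbar hδ h).deriv_eq, norm_deriv_xbar hm hα φm φp ht]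
    exact le_mul_of_one_le_left hspeed.le (le_add_of_nonneg_right (by positivity))

theorem memH1_roundedXbar (hm : 0 < m) (hα : 0 < α) (hα₂ : α < 2) (hδ : 0 < δ) (hT : 0 < T) :
    MemH1 (-T) T (roundedXbar m α φm φp δ) := by
  have hs : ({0, δ, -δ} : Set ℝ).Countable := (toFinite _).countable
  have hne {t : ℝ} (ht : t ∉ ({0, δ, -δ} : Set ℝ)) : t ≠ 0 ∧ |t| ≠ δ :=
    ⟨fun h => ht (by simp [h]), fun h => ht (by rcases (abs_eq hδ.le).1 h with h | h <;> simp [h])⟩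
  exact memH1_of_norm_deriv_le hs (by linarith) (continuous_roundedXbar hα).continuousOn
    (fun _ ht => differentiableAt_roundedXbar hm hα hδ (hne ht.2).2)
    ((memLp_deriv_xbar hm hα hα₂ hT).norm.const_mul _)
    fun _ ht => norm_deriv_roundedXbar_le (φm := φm) (φp := φp) hm hα hδ (hne ht.2).1 (hne ht.2).2

theorem roundedXbar_mem_GammaStar (hm : 0 < m) (hα : 0 < α) (hα₂ : α < 2) (hδ : 0 < δ)
    (hδT : δ ≤ T) : roundedXbar m α φm φp δ ∈ GammaStar m α φm φp T T := by
  have hT := hδ.trans_le hδT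
  have hpos (t : ℝ) := radius_pos hm hα (hδ.trans_le (le_max_right |t| δ))
  refine ⟨memH1_roundedXbar hm hα hα₂ hδ hT,
    fun t _ => norm_pos_iff.1 ((norm_roundedXbar hm hα hδ t).symm ▸ hpos t),
    roundedXbar_eq_xbar hδ (by rwa [abs_neg, abs_of_pos hT]),
    roundedXbar_eq_xbar hδ (by rwa [abs_of_pos hT]),
    fun t => (φp + φm) / 2 + (φp - φm) / 2 * max (-1) (min 1 (t / δ)), by fun_prop,
    fun t _ => by rw [norm_roundedXbar hm hα hδ, roundedXbar], ?_, ?_⟩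
  · simp only [max_min_div_eq_neg_one hδ (neg_le_neg hδT)]
    ring
  · simp only [max_min_div_eq_one hδ hδT]
    ring

theorem xbar_mem_Gamma (hm : 0 < m) (hα : 0 < α) (hα₂ : α < 2) (hT : 0 < T) :
    xbar m α φm φp ∈ Gamma m α φm φp T T := by
  set δ : ℕ → ℝ := fun n => T / (n + 1)
  have hδ (n : ℕ) : 0 < δ n := by positivity
  have hδT (n : ℕ) : δ n ≤ T := div_le_self hT.le (by linarith [n.cast_nonneg (α := ℝ)])
  have hδlim : Tendsto δ atTop (𝓝 0) := by
    simpa [δ, div_eq_mul_inv] using tendsto_one_div_add_atTop_nhds_zero_nat.const_mul T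
  have hmem (n : ℕ) := roundedXbar_mem_GammaStar (φm := φm) (φp := φp) hm hα hα₂ (hδ n) (hδT n)
  have hne (n : ℕ) : ∀ᵐ t, t ≠ 0 ∧ |t| ≠ δ n := by
    filter_upwards [Measure.ae_ne volume 0, Measure.ae_ne volume (δ n),
      Measure.ae_ne volume (-δ n)] with t h0 h1 h2
    exact ⟨h0, fun h => ((abs_eq (hδ n).le).1 h).elim h1 h2⟩
  have hev {t : ℝ} (ht : t ≠ 0) : ∀ᶠ n in atTop, δ n < |t| :=
    hδlim.eventually (gt_mem_nhds (abs_pos.2 ht))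
  refine ⟨memH1_xbar hm hα hα₂ hT, _, hmem, weakH1Tendsto_of_dominated (by linarith)
    (fun n => (hmem n).1) (memLp_const (radius m α T))
    ((memLp_deriv_xbar (φm := φm) (φp := φp) hm hα hα₂ hT).norm.const_mul
      (1 + (α + 2) / 4 * |φp - φm|))
    (fun n => ?_) (fun n => ae_restrict_of_ae ?_) (ae_restrict_of_ae ?_) (ae_restrict_of_ae ?_)⟩
  · filter_upwards [ae_restrict_mem measurableSet_Icc] with t ht
    rw [norm_roundedXbar hm hα (hδ n)]
    exact radius_monotoneOn hm hα (le_max_of_le_left (abs_nonneg t)) hT.le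
      (max_le (abs_le.2 ht) (hδT n))
  · filter_upwards [hne n] with t ht
      using norm_deriv_roundedXbar_le (φm := φm) (φp := φp) hm hα (hδ n) ht.1 ht.2
  · filter_upwards [Measure.ae_ne volume 0] with t ht
    exact tendsto_const_nhds.congr' ((hev ht).mono fun n hn =>
      (roundedXbar_eq_xbar (hδ n) hn.le).symm)
  · filter_upwards [Measure.ae_ne volume 0] with t ht
    exact tendsto_const_nhds.congr' ((hev ht).mono fun n hn =>
      (roundedXbar_eventuallyEq_xbar (hδ n) hn).deriv_eq.symm)

end RoundedCollision

section Minimizers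

variable {m α φm φp T S a b c : ℝ} {x : ℝ → ℂ}

theorem flatHalfAngle_pos (hα₂ : α < 2) (hΔ₀ : 0 < |φp - φm|) : 0 < flatHalfAngle α φm φp := by
  have hβ : 0 < 1 - α / 2 := by linarith
  exact lt_min (by positivity) (by positivity)

theorem flatHalfAngle_lt_pi_div_two (hΔ : (1 - α / 2) * |φp - φm| < Real.pi) :
    flatHalfAngle α φm φp < Real.pi / 2 :=
  (min_le_left _ _).trans_lt (by linarith)

theorem flatHalfAngle_eq_pi_div_two (hΔ : Real.pi ≤ (1 - α / 2) * |φp - φm|) :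
    flatHalfAngle α φm φp = Real.pi / 2 :=
  min_eq_right (by linarith)

theorem halfAction_pos (hm : 0 < m) (hα : 0 < α) (hα₂ : α < 2) (hT : 0 < T) {γ : ℝ}
    (hγ₀ : 0 < γ) (hγ : γ ≤ Real.pi / 2) : 0 < halfAction m α T γ := by
  have hR := radius_pos hm hα hT
  have hsin := Real.sin_pos_of_pos_of_lt_pi hγ₀ (by linarith [Real.pi_pos])
  have hβ : 0 < 1 - α / 2 := by linarith
  unfold halfAction
  positivity

theorem halfAction_flatHalfAngle_pos (hm : 0 < m) (hα : 0 < α) (hα₂ : α < 2) (hT : 0 < T)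
    (hΔ₀ : 0 < |φp - φm|) : 0 < halfAction m α T (flatHalfAngle α φm φp) :=
  halfAction_pos hm hα hα₂ hT (flatHalfAngle_pos hα₂ hΔ₀) (min_le_right _ _)

theorem halfAction_flatHalfAngle_lt (hm : 0 < m) (hα : 0 < α) (hα₂ : α < 2) (hT : 0 < T)
    (hΔ : (1 - α / 2) * |φp - φm| < Real.pi) :
    halfAction m α T (flatHalfAngle α φm φp) < halfAction m α T (Real.pi / 2) :=
  halfAction_strictMonoOn hm hα hα₂ hT (flatHalfAngle_mem_Icc hα₂)
    (right_mem_Icc.2 (by positivity)) (flatHalfAngle_lt_pi_div_two hΔ)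

theorem maupertuis_eq_ofReal_sq {B : ℝ} (hB : 0 ≤ B)
    (hP : potentialIntegral m α (-S) S x = kineticIntegral (-S) S x)
    (hK : kineticIntegral (-S) S x = ENNReal.ofReal B) :
    maupertuis m α S x = ENNReal.ofReal (B ^ 2) := by
  rw [maupertuis, hP, hK, ← sq, ENNReal.ofReal_pow hB]

theorem action_eq_ofReal_two_mul {B : ℝ} (hB : 0 ≤ B)
    (hP : potentialIntegral m α (-S) S x = kineticIntegral (-S) S x)
    (hK : kineticIntegral (-S) S x = ENNReal.ofReal B) :
    action m α S x = ENNReal.ofReal (2 * B) := by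
  rw [action_eq_add, hP, hK, ← ENNReal.ofReal_add hB hB, two_mul]

theorem maupertuis_xbar (hm : 0 < m) (hα : 0 < α) (hα₂ : α < 2) (hT : 0 < T) :
    maupertuis m α T (xbar m α φm φp) =
      ENNReal.ofReal (halfAction m α T (Real.pi / 2) ^ 2) :=
  maupertuis_eq_ofReal_sq (halfAction_pos hm hα hα₂ hT (by positivity) le_rfl).le
    (potentialIntegral_xbar hm hα _ _) (kineticIntegral_xbar hm hα hα₂ hT)

theorem action_xbar (hm : 0 < m) (hα : 0 < α) (hα₂ : α < 2) (hT : 0 < T) :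
    action m α T (xbar m α φm φp) = ENNReal.ofReal (2 * halfAction m α T (Real.pi / 2)) :=
  action_eq_ofReal_two_mul (halfAction_pos hm hα hα₂ hT (by positivity) le_rfl).le
    (potentialIntegral_xbar hm hα _ _) (kineticIntegral_xbar hm hα hα₂ hT)

theorem potentialIntegral_div_kineticIntegral_comp_mul_left (hc : 0 < c)
    (hP : potentialIntegral m α (c * a) (c * b) x = kineticIntegral (c * a) (c * b) x)
    (hK₀ : kineticIntegral (c * a) (c * b) x ≠ 0) (hK : kineticIntegral (c * a) (c * b) x ≠ ∞) :
    potentialIntegral m α a b (fun t => x (c * t)) / kineticIntegral a b (fun t => x (c * t)) =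
      ENNReal.ofReal (c⁻¹ ^ 2) := by
  have hc₀ : ENNReal.ofReal c ≠ 0 := (ENNReal.ofReal_pos.2 hc).ne'
  have hKy := kineticIntegral_comp_mul_left hc x a b
  rw [eq_comm, ENNReal.eq_div_iff (hKy ▸ mul_ne_zero hc₀ hK₀)
    (hKy ▸ ENNReal.mul_ne_top ENNReal.ofReal_ne_top hK), hKy, ← hP,
    potentialIntegral_eq_mul_comp_mul_left hc, ← mul_assoc, mul_right_comm,
    ← ENNReal.ofReal_mul hc.le, ← ENNReal.ofReal_mul (by positivity)]
  field_simp
  rw [ENNReal.ofReal_one, one_mul]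

theorem exists_maupertuis_eq (hm : 0 < m) (hα : 0 < α) (hα₂ : α < 2) (hT : 0 < T)
    (hΔ₀ : 0 < |φp - φm|) :
    ∃ y ∈ Gamma m α φm φp T T,
      maupertuis m α T y = ENNReal.ofReal (halfAction m α T (flatHalfAngle α φm φp) ^ 2) ∧
      ((1 - α / 2) * |φp - φm| < Real.pi → y ∈ GammaStar m α φm φp T T ∧
        ∃ ω : ℝ, 0 < ω ∧
          ENNReal.ofReal (ω ^ 2) = potentialIntegral m α (-T) T y / kineticIntegral (-T) T y ∧
          IsZeroEnergySolution m α (-T / ω) (T / ω) (fun t => y (ω * t))) := by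
  rcases le_or_gt Real.pi ((1 - α / 2) * |φp - φm|) with hwide | hnarrow
  · exact ⟨_, xbar_mem_Gamma hm hα hα₂ hT,
      flatHalfAngle_eq_pi_div_two hwide ▸ maupertuis_xbar hm hα hα₂ hT,
      fun hnarrow => absurd hnarrow hwide.not_gt⟩
  obtain ⟨S, hS, x, hx, hsol, hK⟩ :=
    exists_isZeroEnergySolution_mem_GammaStar hm hα hα₂ hT hΔ₀ hnarrow
  have hP := hsol.potentialIntegral_eq hα
  have hB := halfAction_flatHalfAngle_pos hm hα hα₂ hT hΔ₀
  obtain ⟨c, hc, rfl⟩ : ∃ c, 0 < c ∧ c * T = S := ⟨S / T, by positivity, div_mul_cancel₀ S hT.ne'⟩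
  have hy := comp_mul_left_mem_GammaStar hc hx
  refine ⟨_, GammaStar_subset_Gamma hy, ?_, fun _ => ⟨hy, c⁻¹, inv_pos.2 hc, ?_, ?_⟩⟩
  · rw [maupertuis_comp_mul_left hc, maupertuis_eq_ofReal_sq hB.le hP hK]
  · rw [← mul_neg] at hP hK
    exact (potentialIntegral_div_kineticIntegral_comp_mul_left hc hP
      (hK ▸ (ENNReal.ofReal_pos.2 hB).ne') (hK ▸ ENNReal.ofReal_ne_top)).symm
  · simpa only [mul_inv_cancel_left₀ hc.ne', div_inv_eq_mul, mul_comm _ c, mul_neg] using hsol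

theorem exists_action_eq (hm : 0 < m) (hα : 0 < α) (hα₂ : α < 2) (hT : 0 < T)
    (hΔ₀ : 0 < |φp - φm|) :
    ∃ S : ℝ, 0 < S ∧ ∃ η ∈ Gamma m α φm φp T S,
      action m α S η = ENNReal.ofReal (2 * halfAction m α T (flatHalfAngle α φm φp)) ∧
      ((1 - α / 2) * |φp - φm| < Real.pi →
        η ∈ GammaStar m α φm φp T S ∧ IsZeroEnergySolution m α (-S) S η) := by
  rcases le_or_gt Real.pi ((1 - α / 2) * |φp - φm|) with hwide | hnarrow
  · exact ⟨T, hT, _, xbar_mem_Gamma hm hα hα₂ hT,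
      flatHalfAngle_eq_pi_div_two hwide ▸ action_xbar hm hα hα₂ hT,
      fun hnarrow => absurd hnarrow hwide.not_gt⟩
  obtain ⟨S, hS, x, hx, hsol, hK⟩ :=
    exists_isZeroEnergySolution_mem_GammaStar hm hα hα₂ hT hΔ₀ hnarrow
  exact ⟨S, hS, x, GammaStar_subset_Gamma hx, action_eq_ofReal_two_mul
    (halfAction_flatHalfAngle_pos hm hα hα₂ hT hΔ₀).le (hsol.potentialIntegral_eq hα) hK,
    fun _ => ⟨hx, hsol⟩⟩

theorem maupertuisInf_eq (hm : 0 < m) (hα : 0 < α) (hα₂ : α < 2) (hT : 0 < T)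
    (hΔ₀ : 0 < |φp - φm|) : maupertuisInf m α φm φp T =
      ENNReal.ofReal (halfAction m α T (flatHalfAngle α φm φp) ^ 2) := by
  obtain ⟨y, hy, heq, -⟩ := exists_maupertuis_eq hm hα hα₂ hT hΔ₀
  exact le_antisymm (heq ▸ iInf₂_le y hy)
    (le_iInf₂ fun _ hx => ofReal_sq_halfAction_le_maupertuis hm hα hα₂ hT hT hx)

theorem freeTimeActionInf_eq (hm : 0 < m) (hα : 0 < α) (hα₂ : α < 2) (hT : 0 < T)
    (hΔ₀ : 0 < |φp - φm|) : freeTimeActionInf m α φm φp T =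
      ENNReal.ofReal (2 * halfAction m α T (flatHalfAngle α φm φp)) := by
  obtain ⟨S, hS, η, hη, heq, -⟩ := exists_action_eq hm hα hα₂ hT hΔ₀
  exact le_antisymm (heq ▸ iInf₂_le_of_le S hS (iInf₂_le η hη)) (le_iInf₂ fun _ hS' =>
    le_iInf₂ fun _ hx => ofReal_two_mul_halfAction_le_action hm hα hα₂ hT hS' hx)

theorem mul_abs_sub_lt_pi (hα₂ : α < 2) (hΔ : |φp - φm| ≤ 2 * Real.pi)
    (h : 1 < α ∨ (α = 1 ∧ |φp - φm| < 2 * Real.pi)) : (1 - α / 2) * |φp - φm| < Real.pi := by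
  rcases h with hα | ⟨rfl, hlt⟩
  · calc (1 - α / 2) * |φp - φm| ≤ (1 - α / 2) * (2 * Real.pi) := by
          gcongr
          linarith
      _ < Real.pi := by nlinarith [Real.pi_pos]
  · linarith

end Minimizers

end Kepler

end

theorem mainTheorem5_general (m α T φm φp : ℝ) (hm : 0 < m) (hα : 0 < α) (hα₂ : α < 2)
    (hT : 0 < T) (hφ₀ : 0 < |φp - φm|) :
    (∃ y ∈ Kepler.Gamma m α φm φp T T,
      Kepler.maupertuis m α T y = Kepler.maupertuisInf m α φm φp T ∧
      0 < Kepler.maupertuisInf m α φm φp T ∧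
      Kepler.maupertuisInf m α φm φp T < ⊤ ∧
      ((1 - α / 2) * |φp - φm| < Real.pi →
        y ∈ Kepler.GammaStar m α φm φp T T ∧
        (∃ ω : ℝ, 0 < ω ∧
          ENNReal.ofReal (ω ^ 2) =
            Kepler.potentialIntegral m α (-T) T y / Kepler.kineticIntegral (-T) T y ∧
          Kepler.IsZeroEnergySolution m α (-T / ω) (T / ω) (fun t => y (ω * t))) ∧
        Kepler.maupertuis m α T y < Kepler.maupertuis m α T (Kepler.xbar m α φm φp))) ∧
    (∃ S : ℝ, 0 < S ∧ ∃ η ∈ Kepler.Gamma m α φm φp T S,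
      Kepler.action m α S η = Kepler.freeTimeActionInf m α φm φp T ∧
      Kepler.freeTimeActionInf m α φm φp T < ⊤ ∧
      ((1 - α / 2) * |φp - φm| < Real.pi →
        η ∈ Kepler.GammaStar m α φm φp T S ∧
        Kepler.IsZeroEnergySolution m α (-S) S η ∧
        Kepler.action m α S η < Kepler.action m α T (Kepler.xbar m α φm φp))) := by
  have hB := Kepler.halfAction_flatHalfAngle_pos hm hα hα₂ hT hφ₀
  have hlt := Kepler.halfAction_flatHalfAngle_lt (φm := φm) (φp := φp) hm hα hα₂ hT
  obtain ⟨y, hy, hyeq, hysol⟩ := Kepler.exists_maupertuis_eq hm hα hα₂ hT hφ₀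
  obtain ⟨S, hS, η, hη, hηeq, hηsol⟩ := Kepler.exists_action_eq hm hα hα₂ hT hφ₀
  rw [Kepler.maupertuisInf_eq hm hα hα₂ hT hφ₀, Kepler.freeTimeActionInf_eq hm hα hα₂ hT hφ₀,
    Kepler.maupertuis_xbar hm hα hα₂ hT, Kepler.action_xbar hm hα hα₂ hT]
  refine ⟨⟨y, hy, hyeq, ENNReal.ofReal_pos.2 (by positivity), ENNReal.ofReal_lt_top, fun hΔ => ?_⟩,
    S, hS, η, hη, hηeq, ENNReal.ofReal_lt_top, fun hΔ => ?_⟩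
  · refine ⟨(hysol hΔ).1, (hysol hΔ).2, ?_⟩
    rw [hyeq, ENNReal.ofReal_lt_ofReal_iff (pow_pos (hB.trans (hlt hΔ)) 2)]
    exact pow_lt_pow_left₀ (hlt hΔ) hB.le two_ne_zero
  · refine ⟨(hηsol hΔ).1, (hηsol hΔ).2, ?_⟩
    rw [hηeq, ENNReal.ofReal_lt_ofReal_iff (by linarith [hlt hΔ])]
    linarith [hlt hΔ]

theorem mainTheorem5 (m α T φm φp : ℝ) (hm : 0 < m) (hα₁ : 1 ≤ α) (hα₂ : α < 2) (hT : 0 < T)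
    (hφ₀ : 0 < |φp - φm|) (hφ₁ : |φp - φm| ≤ 2 * Real.pi) :
    (∃ y ∈ Kepler.Gamma m α φm φp T T,
      Kepler.maupertuis m α T y = Kepler.maupertuisInf m α φm φp T ∧
      0 < Kepler.maupertuisInf m α φm φp T ∧
      Kepler.maupertuisInf m α φm φp T < ⊤ ∧
      (1 < α ∨ (α = 1 ∧ |φp - φm| < 2 * Real.pi) →
        y ∈ Kepler.GammaStar m α φm φp T T ∧
        (∃ ω : ℝ, 0 < ω ∧
          ENNReal.ofReal (ω ^ 2) =
            Kepler.potentialIntegral m α (-T) T y / Kepler.kineticIntegral (-T) T y ∧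
          Kepler.IsZeroEnergySolution m α (-T / ω) (T / ω) (fun t => y (ω * t))) ∧
        Kepler.maupertuis m α T y < Kepler.maupertuis m α T (Kepler.xbar m α φm φp))) ∧
    (∃ S : ℝ, 0 < S ∧ ∃ η ∈ Kepler.Gamma m α φm φp T S,
      Kepler.action m α S η = Kepler.freeTimeActionInf m α φm φp T ∧
      Kepler.freeTimeActionInf m α φm φp T < ⊤ ∧
      (1 < α ∨ (α = 1 ∧ |φp - φm| < 2 * Real.pi) →
        η ∈ Kepler.GammaStar m α φm φp T S ∧
        Kepler.IsZeroEnergySolution m α (-S) S η ∧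
        Kepler.action m α S η < Kepler.action m α T (Kepler.xbar m α φm φp))) := by
  obtain ⟨⟨y, hy, hyeq, hpos, htop, hysol⟩, S, hS, η, hη, hηeq, htop', hηsol⟩ :=
    mainTheorem5_general m α T φm φp hm (zero_lt_one.trans_le hα₁) hα₂ hT hφ₀
  exact ⟨⟨y, hy, hyeq, hpos, htop, fun h => hysol (Kepler.mul_abs_sub_lt_pi hα₂ hφ₁ h)⟩,
    S, hS, η, hη, hηeq, htop', fun h => hηsol (Kepler.mul_abs_sub_lt_pi hα₂ hφ₁ h)⟩
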